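/- For a point $p\in\mathbb R^2$ and a compact set $T\subseteq\mathbb R^2$ put $R_{T,p}(\theta)=\sup\{r\ge 0: p+r(\cos\theta,\sin\theta)\in T\}$. Call $\langle T,p\rangle$ a star-shaped domain if $T\subseteq\mathbb R^2$ is compact, $p$ is an interior point of $T$, for every $x\in T$ the segment from $p$ to $x$ is contained in $T$, and $\theta\mapsto R_{T,p}(\theta)$ (the distance from $p$ to $\partial T$ in direction $\theta$) is Lipschitz on $\mathbb R$. Let $\langle T,p\rangle$ be a star-shaped domain, and let $\langle T_1,p_1\rangle,\dots,\langle T_n,p_n\rangle$ be star-shaped domains with $T=\bigcup_i T_i$ and with pairwise disjoint interiors. Then there is a constant $C_1\in\mathbb R$ such that for every function $f:T\to(0,\infty)$ that is constant on the interior of each $T_i$ there is a biLipschitz homeomorphism $\phi:T\to T$ which fixes $\partial T$ pointwise and satisfies $$\operatorname{Jac}(\phi)=\det D_\phi=\frac{|T|}{\int_T f}\cdot f\quad\text{a.e. on }T,\qquad \operatorname{biLip}(\phi)\le\left(\frac{\max f}{\min f}\right)^{C_1}.$$ Here $|T|$ is the area of $T$, $\max f$ and $\min f$ are the largest and the smallest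 of the finitely many values that $f$ takes on $\bigcup_i \operatorname{int}(T_i)$, and $\operatorname{biLip}(\phi)\le L$ means that $\phi$ and $\phi^{-1}$ are both $L$-Lipschitz for the Euclidean distance. -/

import Mathlib

open MeasureTheory Set

noncomputable section

/-- The Euclidean plane. -/
abbrev Plane : Type := EuclideanSpace ℝ (Fin 2)

/-- The unit vector in direction `θ`. -/
def polarDir (θ : ℝ) : Plane := !₂[Real.cos θ, Real.sin θ]

/-- The radial function of `T` at `p`: the distance from `p` to the boundary of `T` in
direction `θ` (for `T` compact and star-shaped about `p`). -/
def radialFun (T : Set Plane) (p : Plane) (θ : ℝ) : ℝ :=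
  sSup {r : ℝ | 0 ≤ r ∧ p + r • polarDir θ ∈ T}

/-- `⟨T, p⟩` is a star-shaped domain: a compact set, with `p` in its interior, such that `p` sees
all of `T`. The regularity of the boundary is that the distance from `p` to the boundary is a
Lipschitz function of the direction; this holds in particular when the boundary is the polar graph
about `p` of a continuous, piecewise `C¹` function. -/
structure IsStarDomain (T : Set Plane) (p : Plane) : Prop where
  isCompact : IsCompact T
  mem_interior : p ∈ interior T
  segment_subset : ∀ x ∈ T, segment ℝ p x ⊆ T
  lipschitz_boundary : ∃ K : NNReal, LipschitzWith K (radialFun T p)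

/-- `T` is partitioned (tiled) into the sets `Ti i`: they cover `T`, lie in `T`, and have pairwise
disjoint interiors. -/
structure IsTilingOf {n : ℕ} (T : Set Plane) (Ti : Fin n → Set Plane) : Prop where
  iUnion_eq : ⋃ i, Ti i = T
  disjoint_interior : ∀ i j, i ≠ j → Disjoint (interior (Ti i)) (interior (Ti j))

/-- `φ` restricts to a biLipschitz homeomorphism of `T` onto itself with biLipschitz constant at
most `L`, i.e. `φ` and its inverse are `L`-Lipschitz on `T` for the Euclidean distance. -/
structure IsBiLipSelfMap (L : ℝ) (φ : Plane → Plane) (T : Set Plane) : Prop where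
  bijOn : BijOn φ T T
  upper : ∀ x ∈ T, ∀ y ∈ T, dist (φ x) (φ y) ≤ L * dist x y
  lower : ∀ x ∈ T, ∀ y ∈ T, dist x y ≤ L * dist (φ x) (φ y)

end

/-! Write `m`, `M` for the smallest and largest value of `f` and `1 + ε = M / m`. Off a null set, `f
/ m` is the density `1 + ∑ a_i 1_{int T_i}` with `0 ≤ a_i ≤ ε`. It suffices to carry this density to
a constant `F` on `T` by a biLipschitz map that is the identity off `int T`. Integrating the
Jacobian equation over `T` then forces `F = ∫_T f / (m |T|)`.

The map is a composition of a number of moves that depends only on the tiling. Composition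
multiplies biLipschitz constants, so each move may cost a fixed power of `1 + ε`. Each move costs at
most a polynomial in `ε` with constant term `1` and coefficients depending only on the geometry, and
Bernoulli's inequality (`one_add_mul_le_rpow`) turns this into such a power for small and large `ε`
alike.

There are three kinds of move. (1) Inside each `T_i`, a radial map about `p_i` concentrates the
excess `a_i` into a Lipschitz bump near `p_i` (`exists_transportable_radial`, inverted). The density
is now `1` plus Lipschitz terms of size `O(ε)`, and the jumps across the tile boundaries are gone.
(2) Each bump is moved along the segment from `p_i` to `p`, inside `int T`, and becomes a multiple
of one bump at `p` (`exists_transportable_move`). This takes three shears, each a monotone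
rearrangement along parallel lines (`FiberPair.transportable`), and the segment may cross other
tiles. (3) A radial map about `p` spreads the central bump evenly over `T`.

The radial maps use the gauge `starGauge`, which is globally Lipschitz because the radial function
is Lipschitz in the angle. -/

/-! ### Lipschitz maps and null sets -/

/-- Lipschitz images of null sets are null for two-dimensional Hausdorff measure, which has the same
null sets as `volume` since both are Haar measures. This lets almost-everywhere Jacobian identities
be pulled back when transports are composed or inverted. -/
theorem volume_preimage_null_of_symm_lipschitz (φ : Plane ≃ Plane) {L : ℝ}
    (hφ : ∀ x y, dist (φ.symm x) (φ.symm y) ≤ L * dist x y) {N : Set Plane}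
    (hN : volume N = 0) : volume (φ ⁻¹' N) = 0 := by
  have hlip : LipschitzWith L.toNNReal φ.symm := LipschitzWith.of_dist_le' hφ
  have hH : Measure.hausdorffMeasure (Module.finrank ℝ Plane : ℝ) N = 0 :=
    Measure.absolutelyContinuous_isAddHaarMeasure _ volume hN
  have himg := hlip.hausdorffMeasure_image_le (d := (Module.finrank ℝ Plane : ℝ))
    (by positivity) N
  rw [hH, mul_zero, nonpos_iff_eq_zero, Equiv.image_symm_eq_preimage] at himg
  exact Measure.absolutelyContinuous_isAddHaarMeasure volume _ himg

/-! ### Transport of densities by biLipschitz homeomorphisms -/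

/-- `φ` is an `L`-biLipschitz homeomorphism of the plane, equal to the identity off `U`, that
carries the density `ρ` to the density `ρ'`. -/
structure IsTransport (φ : Plane ≃ Plane) (U : Set Plane) (L : ℝ) (ρ ρ' : Plane → ℝ) :
    Prop where
  lip : ∀ x y, dist (φ x) (φ y) ≤ L * dist x y
  lip_symm : ∀ x y, dist (φ.symm x) (φ.symm y) ≤ L * dist x y
  eq_off : ∀ x ∉ U, φ x = x
  jac : ∀ᵐ x, DifferentiableAt ℝ φ x ∧ (fderiv ℝ φ x).det * ρ' (φ x) = ρ x

/-- Some `L`-biLipschitz homeomorphism of the plane, equal to the identity off `U`, carries the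
density `ρ` to the density `ρ'`. -/
def Transportable (U : Set Plane) (L : ℝ) (ρ ρ' : Plane → ℝ) : Prop :=
  ∃ φ : Plane ≃ Plane, IsTransport φ U L ρ ρ'

namespace Transportable

variable {U V : Set Plane} {L L₁ L₂ : ℝ} {ρ ρ₁ ρ₂ ρ₃ : Plane → ℝ}

theorem refl (U : Set Plane) (ρ : Plane → ℝ) : Transportable U 1 ρ ρ :=
  ⟨Equiv.refl _, by simp, by simp, by simp, Filter.Eventually.of_forall fun x => by
    have h : ((Equiv.refl Plane : Plane ≃ Plane) : Plane → Plane) = id := rfl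
    rw [h]
    exact ⟨differentiableAt_id, by simp [ContinuousLinearMap.det]⟩⟩

theorem mono (h : Transportable U L₁ ρ₁ ρ₂) (hL : L₁ ≤ L₂) (hU : U ⊆ V) :
    Transportable V L₂ ρ₁ ρ₂ := by
  obtain ⟨φ, h⟩ := h
  exact ⟨φ, fun x y => (h.lip x y).trans (by gcongr), fun x y => (h.lip_symm x y).trans (by gcongr),
    fun x hx => h.eq_off x fun hx' => hx (hU hx'), h.jac⟩

theorem symm (h : Transportable U L ρ₁ ρ₂) : Transportable U L ρ₂ ρ₁ := by
  obtain ⟨φ, h⟩ := h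
  refine ⟨φ.symm, h.lip_symm, by simpa using h.lip, fun x hx => ?_, ?_⟩
  · rw [Equiv.symm_apply_eq, h.eq_off x hx]
  -- Rademacher's theorem gives a derivative of the inverse almost everywhere; the chain rule then
  -- makes the two determinants reciprocal.
  have hd : ∀ᵐ y, DifferentiableAt ℝ φ.symm y :=
    (LipschitzWith.of_dist_le' h.lip_symm).ae_differentiableAt
  have hp : ∀ᵐ y, DifferentiableAt ℝ φ (φ.symm y) ∧
      (fderiv ℝ φ (φ.symm y)).det * ρ₂ (φ (φ.symm y)) = ρ₁ (φ.symm y) :=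
    volume_preimage_null_of_symm_lipschitz φ.symm (by simpa using h.lip) h.jac
  filter_upwards [hd, hp] with y hy hφ
  refine ⟨hy, ?_⟩
  have hcomp : (fderiv ℝ φ.symm y).comp (fderiv ℝ φ (φ.symm y)) = ContinuousLinearMap.id ℝ _ := by
    have h1 : HasFDerivAt φ.symm (fderiv ℝ φ.symm y) (φ (φ.symm y)) := by
      rw [φ.apply_symm_apply]; exact hy.hasFDerivAt
    have h2 := h1.comp (φ.symm y) hφ.1.hasFDerivAt
    have h3 : (φ.symm : Plane → Plane) ∘ φ = id := by ext1 x; simp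
    rw [h3] at h2
    exact h2.unique (hasFDerivAt_id _)
  have hdet : (fderiv ℝ φ.symm y).det * (fderiv ℝ φ (φ.symm y)).det = 1 := by
    have := congrArg ContinuousLinearMap.det hcomp
    simpa [ContinuousLinearMap.det, LinearMap.det_comp] using this
  rw [← hφ.2, φ.apply_symm_apply, ← mul_assoc, hdet, one_mul]

theorem trans (h₁ : Transportable U L₁ ρ₁ ρ₂) (h₂ : Transportable U L₂ ρ₂ ρ₃)
    (hL₁ : 0 ≤ L₁) (hL₂ : 0 ≤ L₂) : Transportable U (L₁ * L₂) ρ₁ ρ₃ := by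
  obtain ⟨φ, h₁⟩ := h₁
  obtain ⟨ψ, h₂⟩ := h₂
  refine ⟨φ.trans ψ, fun x y => ?_, fun x y => ?_, fun x hx => ?_, ?_⟩
  · calc dist (ψ (φ x)) (ψ (φ y)) ≤ L₂ * dist (φ x) (φ y) := h₂.lip _ _
      _ ≤ L₂ * (L₁ * dist x y) := by gcongr; exact h₁.lip _ _
      _ = _ := by ring
  · calc dist (φ.symm (ψ.symm x)) (φ.symm (ψ.symm y)) ≤ L₁ * dist (ψ.symm x) (ψ.symm y) :=
        h₁.lip_symm _ _
      _ ≤ L₁ * (L₂ * dist x y) := by gcongr; exact h₂.lip_symm _ _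
      _ = _ := by ring
  · simp [h₁.eq_off x hx, h₂.eq_off x hx]
  have hp : ∀ᵐ x, DifferentiableAt ℝ ψ (φ x) ∧
      (fderiv ℝ ψ (φ x)).det * ρ₃ (ψ (φ x)) = ρ₂ (φ x) :=
    volume_preimage_null_of_symm_lipschitz φ h₁.lip_symm h₂.jac
  filter_upwards [hp, h₁.jac] with x hψ hφ
  rw [Equiv.coe_trans]
  refine ⟨hψ.1.comp x hφ.1, ?_⟩
  rw [fderiv_comp x hψ.1 hφ.1, ← hφ.2, ← hψ.2]
  simp only [ContinuousLinearMap.det, ContinuousLinearMap.toLinearMap_comp, LinearMap.det_comp,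
    Function.comp_apply]
  ring

theorem trans_rpow {t c₁ c₂ : ℝ} (ht : 0 < t) (h₁ : Transportable U (t ^ c₁) ρ₁ ρ₂)
    (h₂ : Transportable U (t ^ c₂) ρ₂ ρ₃) : Transportable U (t ^ (c₁ + c₂)) ρ₁ ρ₃ := by
  rw [Real.rpow_add ht]
  exact h₁.trans h₂ (by positivity) (by positivity)

end Transportable

/-- Bernoulli's inequality needs an exponent at least `1`, hence the maximum. This is how linear
estimates become powers of `max f / min f`. -/
theorem one_add_mul_le_rpow {C ε : ℝ} (hε : 0 ≤ ε) : 1 + C * ε ≤ (1 + ε) ^ (max C 1) := by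
  have := one_add_mul_self_le_rpow_one_add (s := ε) (by linarith) (le_max_right C 1)
  have h2 : C * ε ≤ max C 1 * ε := by gcongr; exact le_max_left _ _
  linarith

/-- The linear endomorphism `c • id + ℓ ⊗ w` of the plane has determinant `c ^ 2 + c * ℓ w`. -/
theorem det_smul_id_add_smulRight (c : ℝ) (ℓ : Plane →L[ℝ] ℝ) (w : Plane) :
    (c • ContinuousLinearMap.id ℝ Plane + ℓ.smulRight w).det = c ^ 2 + c * ℓ w := by
  have hw : w = w 0 • EuclideanSpace.single 0 (1 : ℝ) + w 1 • EuclideanSpace.single 1 (1 : ℝ) := by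
    ext i; fin_cases i <;> simp
  have hℓ : ℓ w = w 0 * ℓ (EuclideanSpace.single 0 1) + w 1 * ℓ (EuclideanSpace.single 1 1) := by
    conv_lhs => rw [hw]
    simp
  rw [ContinuousLinearMap.det, ← LinearMap.det_toMatrix (EuclideanSpace.basisFun (Fin 2) ℝ).toBasis,
    Matrix.det_fin_two, hℓ]
  simp [LinearMap.toMatrix_apply]
  ring

/-! ### Radial gauges -/

/-- `g` is a Lipschitz function that is positively homogeneous about `p` and dominates the distance
to `p`. -/
structure IsRadialGauge (g : Plane → ℝ) (p : Plane) (K R : ℝ) : Prop where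
  nonneg : ∀ x, 0 ≤ g x
  lip : ∀ x y, |g x - g y| ≤ K * dist x y
  hom : ∀ t : ℝ, 0 ≤ t → ∀ v, g (p + t • v) = t * g (p + v)
  dist_le : ∀ x, dist x p ≤ R * g x

namespace IsRadialGauge

variable {g : Plane → ℝ} {p : Plane} {K R : ℝ}

theorem lipschitzWith (hg : IsRadialGauge g p K R) : LipschitzWith K.toNNReal g :=
  LipschitzWith.of_dist_le' fun x y => by rw [Real.dist_eq]; exact hg.lip x y

theorem continuous (hg : IsRadialGauge g p K R) : Continuous g := hg.lipschitzWith.continuous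

theorem center (hg : IsRadialGauge g p K R) : g p = 0 := by
  simpa using hg.hom 0 le_rfl 0

theorem nonneg_right (hg : IsRadialGauge g p K R) : 0 ≤ R := by
  obtain ⟨x, hx⟩ := exists_ne p
  have h1 := hg.dist_le x
  have h2 := hg.nonneg x
  have h3 : 0 < dist x p := dist_pos.2 hx
  by_contra! hR
  nlinarith

theorem nonneg_left (hg : IsRadialGauge g p K R) : 0 ≤ K := by
  obtain ⟨x, hx⟩ := exists_ne p
  have h3 : 0 < dist x p := dist_pos.2 hx
  have h1 := (abs_nonneg _).trans (hg.lip x p)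
  by_contra! hK
  nlinarith

theorem pos (hg : IsRadialGauge g p K R) {x : Plane} (hx : x ≠ p) : 0 < g x := by
  have h1 := hg.dist_le x
  have h3 : 0 < dist x p := dist_pos.2 hx
  rcases (hg.nonneg x).eq_or_lt with h | h
  · rw [← h, mul_zero] at h1; linarith
  · exact h

/-- Euler's relation for a function homogeneous of degree one: differentiate along the ray from `p`
through `x` at parameter `1`. -/
theorem fderiv_apply_sub (hg : IsRadialGauge g p K R) {x : Plane} (hx : DifferentiableAt ℝ g x) :
    fderiv ℝ g x (x - p) = g x := by
  have h1 : HasDerivAt (fun t : ℝ => p + t • (x - p)) (x - p) 1 := by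
    simpa using ((hasDerivAt_id (1 : ℝ)).smul_const (x - p)).const_add p
  have hx' : HasFDerivAt g (fderiv ℝ g x) (p + (1 : ℝ) • (x - p)) := by
    simpa using hx.hasFDerivAt
  have h2 := hx'.comp_hasDerivAt (1 : ℝ) h1
  have h3 : HasDerivAt (fun t : ℝ => t * g x) (g x) 1 := by
    simpa using (hasDerivAt_id (1 : ℝ)).mul_const (g x)
  refine h2.unique (h3.congr_of_eventuallyEq ?_)
  filter_upwards [lt_mem_nhds (zero_lt_one : (0 : ℝ) < 1)] with t ht
  simp [hg.hom t ht.le]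

/-- Only countably many of the disjoint level sets can have positive measure, so some positive level
is null. All positive levels are homothetic, so all of them are null. -/
theorem volume_level_eq_zero (hg : IsRadialGauge g p K R) {s : ℝ} (hs : 0 < s) :
    volume {x | g x = s} = 0 := by
  have hc := Measure.countable_meas_level_set_pos (μ := (volume : Measure Plane))
    hg.continuous.measurable
  obtain ⟨t, ht, ht'⟩ : ∃ t, t ∈ Ioi (0 : ℝ) ∧ ¬ 0 < volume {x | g x = t} := by
    by_contra! h
    have h0 := (hc.mono (s₁ := Ioi 0) fun t ht => h t ht).measure_zero (volume : Measure ℝ)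
    simp at h0
  have ht0 : (0 : ℝ) < t := ht
  have hsub : {x | g x = s} ⊆ AffineMap.homothety p (s / t) '' {x | g x = t} := by
    intro x hx
    have hx : g x = s := hx
    refine ⟨p + (t / s) • (x - p), ?_, ?_⟩
    · change g _ = t
      rw [hg.hom _ (by positivity), add_sub_cancel, hx]
      field_simp
    · rw [AffineMap.homothety_apply]
      simp only [vsub_eq_sub, add_sub_cancel_left, vadd_eq_add, smul_smul]
      rw [show s / t * (t / s) = 1 by field_simp]
      simp
  refine measure_mono_null hsub ?_
  rw [Measure.addHaar_image_homothety, nonpos_iff_eq_zero.1 (not_lt.1 ht'), mul_zero]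

end IsRadialGauge

/-! ### The gauge of a star-shaped domain -/

/-- The polar angle of a vector. -/
noncomputable def planeArg (v : Plane) : ℝ := Complex.arg ⟨v 0, v 1⟩

theorem norm_smul_polarDir_planeArg (v : Plane) : ‖v‖ • polarDir (planeArg v) = v := by
  have hn : ‖v‖ = ‖(⟨v 0, v 1⟩ : ℂ)‖ := by
    rw [EuclideanSpace.norm_eq, Complex.norm_def, Complex.normSq_mk]
    simp [Fin.sum_univ_two, sq]
  ext i
  fin_cases i
  · simp [polarDir, hn, planeArg]
  · simp [polarDir, hn, planeArg]

theorem planeArg_smul {t : ℝ} (ht : 0 < t) (v : Plane) : planeArg (t • v) = planeArg v := by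
  have : (⟨(t • v) 0, (t • v) 1⟩ : ℂ) = (t : ℂ) * ⟨v 0, v 1⟩ := by
    apply Complex.ext <;> simp
  rw [planeArg, this, Complex.arg_real_mul _ ht, planeArg]

theorem norm_polarDir (θ : ℝ) : ‖polarDir θ‖ = 1 := by
  simp [EuclideanSpace.norm_eq, polarDir, Fin.sum_univ_two]

theorem polarDir_periodic : Function.Periodic polarDir (2 * Real.pi) := fun θ => by
  simp [polarDir]

theorem norm_polarDir_sub (a b : ℝ) :
    ‖polarDir a - polarDir b‖ = 2 * |Real.sin ((a - b) / 2)| := by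
  have h : ‖polarDir a - polarDir b‖ ^ 2 = (2 * |Real.sin ((a - b) / 2)|) ^ 2 := by
    rw [EuclideanSpace.norm_eq, Real.sq_sqrt (by positivity)]
    have h1 : Real.cos (a - b) = 1 - 2 * Real.sin ((a - b) / 2) ^ 2 := by
      have := Real.cos_two_mul ((a - b) / 2)
      rw [Real.cos_sq'] at this
      rw [show a - b = 2 * ((a - b) / 2) by ring, this]; ring_nf
    rw [Real.cos_sub] at h1
    simp only [polarDir, Fin.sum_univ_two, Real.norm_eq_abs, sq_abs, mul_pow]
    simp
    nlinarith [Real.sin_sq_add_cos_sq a, Real.sin_sq_add_cos_sq b]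
  exact (pow_left_inj₀ (by positivity) (by positivity) two_ne_zero).1 h

/-- A periodic Lipschitz function of the angle is Lipschitz in the direction. -/
theorem abs_sub_le_of_lipschitz_periodic {F : ℝ → ℝ} {K : NNReal} (hF : LipschitzWith K F)
    (hper : Function.Periodic F (2 * Real.pi)) (a b : ℝ) :
    |F a - F b| ≤ K * (Real.pi / 2) * ‖polarDir a - polarDir b‖ := by
  -- Replacing `a` by its representative within `π` of `b` makes Jordan's inequality for the sine
  -- applicable, and makes the branch cut of `planeArg` harmless.
  obtain ⟨c, hc, hFc, hpc⟩ : ∃ c, |c - b| ≤ Real.pi ∧ F c = F a ∧ polarDir c = polarDir a := by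
    have h2 : (0 : ℝ) < 2 * Real.pi := by positivity
    refine ⟨toIcoMod h2 (b - Real.pi) a, ?_, ?_, ?_⟩
    · have := toIcoMod_mem_Ico h2 (b - Real.pi) a
      rw [abs_le]
      constructor <;> linarith [this.1, this.2]
    · rw [toIcoMod]; exact hper.sub_zsmul_eq _
    · rw [toIcoMod]; exact polarDir_periodic.sub_zsmul_eq _
  rw [← hFc, ← hpc, norm_polarDir_sub]
  have h1 := hF.dist_le_mul c b
  rw [Real.dist_eq, Real.dist_eq] at h1
  have h2 : 2 / Real.pi * |(c - b) / 2| ≤ |Real.sin ((c - b) / 2)| :=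
    Real.mul_abs_le_abs_sin (by rw [abs_div, abs_two]; linarith)
  have h3 : |c - b| ≤ Real.pi / 2 * (2 * |Real.sin ((c - b) / 2)|) := by
    rw [abs_div, abs_two] at h2
    calc |c - b| = Real.pi * (2 / Real.pi * (|c - b| / 2)) := by field_simp
      _ ≤ Real.pi * |Real.sin ((c - b) / 2)| := by gcongr
      _ = _ := by ring
  calc |F c - F b| ≤ K * |c - b| := h1
    _ ≤ K * (Real.pi / 2 * (2 * |Real.sin ((c - b) / 2)|)) := by gcongr
    _ = _ := by ring

/-- The gauge of `T` about `p`: the ratio of the distance to `p` and the radial function. -/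
noncomputable def starGauge (T : Set Plane) (p x : Plane) : ℝ :=
  dist x p / radialFun T p (planeArg (x - p))

namespace IsStarDomain

variable {T : Set Plane} {p : Plane}

theorem isCompact_radii (hT : IsStarDomain T p) (θ : ℝ) :
    IsCompact {r : ℝ | 0 ≤ r ∧ p + r • polarDir θ ∈ T} := by
  refine Metric.isCompact_of_isClosed_isBounded ?_ ?_
  · exact isClosed_Ici.inter (hT.isCompact.isClosed.preimage (by fun_prop))
  · obtain ⟨R, hR⟩ := hT.isCompact.isBounded.subset_closedBall p
    refine (Metric.isBounded_Icc (0 : ℝ) R).subset fun r hr => ⟨hr.1, ?_⟩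
    have := hR hr.2
    simpa [norm_smul, norm_polarDir, abs_of_nonneg hr.1] using this

theorem add_smul_polarDir_mem_iff (hT : IsStarDomain T p) (θ : ℝ) {r : ℝ} (hr : 0 ≤ r) :
    p + r • polarDir θ ∈ T ↔ r ≤ radialFun T p θ := by
  have hc := hT.isCompact_radii θ
  constructor
  · exact fun h => le_csSup hc.bddAbove ⟨hr, h⟩
  · intro h
    have hne : {r : ℝ | 0 ≤ r ∧ p + r • polarDir θ ∈ T}.Nonempty :=
      ⟨0, le_rfl, by simpa using interior_subset hT.mem_interior⟩
    have hs := hc.sSup_mem hne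
    change 0 ≤ radialFun T p θ ∧ p + radialFun T p θ • polarDir θ ∈ T at hs
    rcases hs.1.eq_or_lt with h0 | h0
    · rw [← h0] at h hs
      rw [le_antisymm h hr]; exact hs.2
    · refine hT.segment_subset _ hs.2 ?_
      rw [segment_eq_image']
      refine ⟨r / radialFun T p θ, ⟨by positivity, (div_le_one h0).2 h⟩, ?_⟩
      simp only [add_sub_cancel_left, smul_smul]
      rw [div_mul_cancel₀ _ h0.ne']

theorem exists_radialFun_bounds (hT : IsStarDomain T p) :
    ∃ r R : ℝ, 0 < r ∧ ∀ θ, r ≤ radialFun T p θ ∧ radialFun T p θ ≤ R := by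
  obtain ⟨r, hr, hrT⟩ := Metric.nhds_basis_closedBall.mem_iff.1 (mem_interior_iff_mem_nhds.1
    hT.mem_interior)
  obtain ⟨R, hR⟩ := hT.isCompact.isBounded.subset_closedBall p
  refine ⟨r, R, hr, fun θ => ?_⟩
  have h1 : r ≤ radialFun T p θ := (hT.add_smul_polarDir_mem_iff θ hr.le).1 <| hrT <| by
    simp [norm_smul, norm_polarDir, abs_of_pos hr]
  refine ⟨h1, ?_⟩
  have h2 := hR ((hT.add_smul_polarDir_mem_iff θ (hr.le.trans h1)).2 le_rfl)
  simpa [norm_smul, norm_polarDir, abs_of_nonneg (hr.le.trans h1)] using h2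

theorem isRadialGauge (hT : IsStarDomain T p) :
    ∃ K R, IsRadialGauge (starGauge T p) p K R := by
  obtain ⟨r, R, hr, hb⟩ := hT.exists_radialFun_bounds
  obtain ⟨K, hK⟩ := hT.lipschitz_boundary
  have hpos : ∀ θ, 0 < radialFun T p θ := fun θ => hr.trans_le (hb θ).1
  have hper : Function.Periodic (radialFun T p) (2 * Real.pi) := fun θ => by
    simp only [radialFun, polarDir_periodic θ]
  refine ⟨1 / r + K * (Real.pi / 2) * 2 / r ^ 2, R,
    fun x => div_nonneg dist_nonneg (hpos _).le, ?_, ?_, ?_⟩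
  · intro x y
    wlog hxy : dist y p ≤ dist x p generalizing x y with H
    · rw [abs_sub_comm, dist_comm]; exact H y x (le_of_not_ge hxy)
    simp only [starGauge]
    set a := planeArg (x - p) with ha
    set b := planeArg (y - p) with hb'
    have hx := norm_smul_polarDir_planeArg (x - p)
    have hy := norm_smul_polarDir_planeArg (y - p)
    rw [← ha, ← dist_eq_norm] at hx
    rw [← hb', ← dist_eq_norm] at hy
    have hdd : |dist x p - dist y p| ≤ dist x y := by
      simpa [dist_comm] using abs_dist_sub_le x y p
    -- The direction seen from `p` is not uniformly Lipschitz near `p`; the weight `dist y p`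
    -- compensates exactly for this.
    have hdir : dist y p * ‖polarDir a - polarDir b‖ ≤ 2 * dist x y := by
      have : dist y p • (polarDir a - polarDir b)
          = (x - y) - (dist x p - dist y p) • polarDir a := by
        rw [smul_sub, hy, sub_smul, hx]; abel
      calc dist y p * ‖polarDir a - polarDir b‖
          = ‖dist y p • (polarDir a - polarDir b)‖ := by
            rw [norm_smul, Real.norm_of_nonneg dist_nonneg]
        _ ≤ ‖x - y‖ + ‖(dist x p - dist y p) • polarDir a‖ := by rw [this]; exact norm_sub_le _ _
        _ ≤ dist x y + dist x y := by
            rw [norm_smul, norm_polarDir, mul_one, Real.norm_eq_abs, ← dist_eq_norm]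
            gcongr
        _ = _ := by ring
    have hF := abs_sub_le_of_lipschitz_periodic hK hper a b
    have hsplit : dist x p / radialFun T p a - dist y p / radialFun T p b
        = (dist x p - dist y p) / radialFun T p a
          - dist y p * (radialFun T p a - radialFun T p b)
            / (radialFun T p a * radialFun T p b) := by
      have := (hpos a).ne'
      have := (hpos b).ne'
      field_simp
      ring
    rw [hsplit]
    refine (abs_sub _ _).trans ?_
    rw [abs_div, abs_div, abs_mul, abs_of_pos (hpos a), abs_of_pos (mul_pos (hpos a) (hpos b)),
      abs_of_nonneg (dist_nonneg : 0 ≤ dist y p), add_mul]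
    gcongr ?_ + ?_
    · rw [one_div, inv_mul_eq_div]
      exact div_le_div₀ dist_nonneg hdd hr (hb a).1
    · rw [div_mul_eq_mul_div]
      refine div_le_div₀ (by positivity) ?_ (by positivity) ?_
      · calc dist y p * |radialFun T p a - radialFun T p b|
            ≤ dist y p * (K * (Real.pi / 2) * ‖polarDir a - polarDir b‖) := by gcongr
          _ = K * (Real.pi / 2) * (dist y p * ‖polarDir a - polarDir b‖) := by ring
          _ ≤ K * (Real.pi / 2) * (2 * dist x y) := by gcongr
          _ = _ := by ring
      · rw [sq]; exact mul_le_mul (hb a).1 (hb b).1 hr.le (hpos a).le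
  · intro t ht v
    rcases ht.eq_or_lt with rfl | ht
    · simp [starGauge]
    · simp only [starGauge, add_sub_cancel_left, planeArg_smul ht, dist_eq_norm, norm_smul,
        Real.norm_eq_abs, abs_of_pos ht, mul_div_assoc]
  · intro x
    have h := hpos (planeArg (x - p))
    rw [starGauge, mul_div_assoc', le_div_iff₀ h, mul_comm]
    gcongr
    exact (hb _).2

theorem mem_iff_starGauge_le (hT : IsStarDomain T p) (x : Plane) :
    x ∈ T ↔ starGauge T p x ≤ 1 := by
  obtain ⟨r, R, hr, hb⟩ := hT.exists_radialFun_bounds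
  have h := hT.add_smul_polarDir_mem_iff (planeArg (x - p)) (norm_nonneg (x - p))
  rw [norm_smul_polarDir_planeArg, add_sub_cancel] at h
  rw [h, starGauge, div_le_one (hr.trans_le (hb _).1), dist_eq_norm]

theorem mem_interior_iff_starGauge_lt (hT : IsStarDomain T p) (x : Plane) :
    x ∈ interior T ↔ starGauge T p x < 1 := by
  obtain ⟨K, R, hg⟩ := hT.isRadialGauge
  constructor
  · intro hx
    refine lt_of_le_of_ne ((hT.mem_iff_starGauge_le x).1 (interior_subset hx)) fun h1 => ?_
    have hcont : Continuous fun t : ℝ => p + t • (x - p) := by fun_prop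
    have hmem : ∀ᶠ t in nhds (1 : ℝ), p + t • (x - p) ∈ T := by
      refine hcont.continuousAt.eventually_mem ?_
      simpa using mem_interior_iff_mem_nhds.1 hx
    obtain ⟨δ, hδ, hball⟩ := Metric.eventually_nhds_iff.1 hmem
    -- An interior point at gauge `1` could be pushed outwards along its ray and stay in `T`, but
    -- its gauge would then exceed `1`.
    have h2 := hball (y := 1 + δ / 2) (by simp [abs_of_pos hδ]; linarith)
    rw [hT.mem_iff_starGauge_le, hg.hom _ (by positivity), add_sub_cancel, h1] at h2
    linarith
  · intro hx
    refine interior_maximal (t := {x | starGauge T p x < 1}) ?_ ?_ hx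
    · exact fun y hy => (hT.mem_iff_starGauge_le y).2 (le_of_lt hy)
    · exact isOpen_lt hg.continuous continuous_const

end IsStarDomain

/-! ### Radial rearrangement -/

/-- The `C¹` profile equal to `2 - q ^ 2` on `[0, 1]` and to `q ^ (-2)` on `[1, ∞)`. -/
noncomputable def radialProfile (q : ℝ) : ℝ := if q ≤ 1 then 2 - q ^ 2 else 1 / q ^ 2

/-- The bump profile `(q ^ 2 * radialProfile q)' / (2 * q) = 2 * max 0 (1 - q ^ 2)`. -/
noncomputable def bumpProfile (q : ℝ) : ℝ := 2 * (1 - min q 1 ^ 2)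

theorem bumpProfile_nonneg {q : ℝ} (hq : 0 ≤ q) : 0 ≤ bumpProfile q := by
  have h0 : 0 ≤ min q 1 := le_min hq zero_le_one
  have h1 : min q 1 ≤ 1 := min_le_right _ _
  rw [bumpProfile]; nlinarith

theorem bumpProfile_eq_zero {q : ℝ} (hq : 1 ≤ q) : bumpProfile q = 0 := by
  simp [bumpProfile, min_eq_right hq]

theorem abs_bumpProfile_sub_le {s t : ℝ} (hs : 0 ≤ s) (ht : 0 ≤ t) :
    |bumpProfile s - bumpProfile t| ≤ 4 * |s - t| := by
  have h0 : 0 ≤ min s 1 := le_min hs zero_le_one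
  have h0' : 0 ≤ min t 1 := le_min ht zero_le_one
  have h1 : |min s 1 - min t 1| ≤ |s - t| := by
    simpa using abs_min_sub_min_le_max s 1 t 1
  have h2 : |min s 1 + min t 1| ≤ 2 := by
    rw [abs_of_nonneg (by positivity)]
    linarith [min_le_right s 1, min_le_right t 1]
  calc |bumpProfile s - bumpProfile t| = 2 * (|min s 1 + min t 1| * |min s 1 - min t 1|) := by
        have e : bumpProfile s - bumpProfile t
            = -(2 * ((min s 1 + min t 1) * (min s 1 - min t 1))) := by
          rw [bumpProfile, bumpProfile]; ring
        rw [e, abs_neg, abs_mul, abs_mul, abs_two]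
    _ ≤ 2 * (2 * |s - t|) := by gcongr
    _ = _ := by ring

theorem radialProfile_of_one_le {q : ℝ} (hq : 1 ≤ q) : radialProfile q = 1 / q ^ 2 := by
  rw [radialProfile]
  split_ifs with h
  · rw [le_antisymm h hq]; norm_num
  · rfl

theorem radialProfile_le_two {q : ℝ} : radialProfile q ≤ 2 := by
  rw [radialProfile]
  split_ifs with h
  · nlinarith [sq_nonneg q]
  · push Not at h
    rw [div_le_iff₀ (by positivity)]
    nlinarith

theorem radialProfile_sub_bounds {s t : ℝ} (hs : 0 ≤ s) (hst : s ≤ t) :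
    0 ≤ radialProfile s - radialProfile t ∧ radialProfile s - radialProfile t ≤ 2 * (t - s) := by
  have low : ∀ s t : ℝ, 0 ≤ s → s ≤ t → t ≤ 1 → 0 ≤ radialProfile s - radialProfile t ∧
      radialProfile s - radialProfile t ≤ 2 * (t - s) := by
    intro s t hs hst ht
    rw [radialProfile, radialProfile, if_pos ht, if_pos (hst.trans ht)]
    constructor <;> nlinarith
  have high : ∀ s t : ℝ, 1 ≤ s → s ≤ t → 0 ≤ radialProfile s - radialProfile t ∧
      radialProfile s - radialProfile t ≤ 2 * (t - s) := by
    intro s t hs hst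
    have hs0 : 0 < s := by linarith
    have ht0 : 0 < t := by linarith
    rw [radialProfile_of_one_le hs, radialProfile_of_one_le (hs.trans hst)]
    have : 1 / s ^ 2 - 1 / t ^ 2 = (1 / (s * t ^ 2) + 1 / (s ^ 2 * t)) * (t - s) := by
      field_simp; ring
    rw [this]
    have h1 : 1 / (s * t ^ 2) ≤ 1 := by
      rw [div_le_one (by positivity)]
      nlinarith [one_le_pow₀ (hs.trans hst) (n := 2)]
    have h2 : 1 / (s ^ 2 * t) ≤ 1 := by
      rw [div_le_one (by positivity)]
      nlinarith [one_le_pow₀ hs (n := 2)]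
    have h3 : 0 ≤ 1 / (s * t ^ 2) := by positivity
    have h4 : 0 ≤ 1 / (s ^ 2 * t) := by positivity
    constructor <;> nlinarith
  rcases le_total t 1 with ht | ht
  · exact low s t hs hst ht
  · rcases le_total s 1 with hs1 | hs1
    · have h1 := low s 1 hs hs1 le_rfl
      have h2 := high 1 t le_rfl ht
      constructor <;> linarith [h1.1, h1.2, h2.1, h2.2]
    · exact high s t hs1 hst

/-- Up to normalization, `q ^ 2 * radialProfile q` is the mass of the bump within radius `q`. It
equals `1 - (1 - q ^ 2) ^ 2` up to `q = 1` and `1` from there on. -/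
theorem sq_mul_radialProfile_mono {s t : ℝ} (hs : 0 ≤ s) (hst : s ≤ t) :
    s ^ 2 * radialProfile s ≤ t ^ 2 * radialProfile t := by
  have high : ∀ t : ℝ, 1 ≤ t → t ^ 2 * radialProfile t = 1 := by
    intro t ht
    rw [radialProfile_of_one_le ht]
    have : t ≠ 0 := by linarith
    field_simp
  have low : ∀ t : ℝ, t ≤ 1 → t ^ 2 * radialProfile t = 1 - (1 - t ^ 2) ^ 2 := by
    intro t ht
    rw [radialProfile, if_pos ht]; ring
  rcases le_total t 1 with ht | ht
  · rw [low t ht, low s (hst.trans ht)]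
    have : 1 - t ^ 2 ≤ 1 - s ^ 2 := by nlinarith
    have : 0 ≤ 1 - t ^ 2 := by nlinarith
    gcongr
  · rw [high t ht]
    rcases le_total s 1 with hs1 | hs1
    · rw [low s hs1]; nlinarith [sq_nonneg (1 - s ^ 2)]
    · rw [high s hs1]

theorem exists_hasDerivAt_radialProfile {q : ℝ} (hq : 0 < q) (hq1 : q ≠ 1) :
    ∃ k, HasDerivAt radialProfile k q ∧ radialProfile q + q * k / 2 = bumpProfile q := by
  rcases hq1.lt_or_gt with h | h
  · refine ⟨-(2 * q), ?_, ?_⟩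
    · have h1 : HasDerivAt (fun q : ℝ => 2 - q ^ 2) (-(2 * q)) q := by
        simpa using (hasDerivAt_pow 2 q).const_sub 2
      refine h1.congr_of_eventuallyEq ?_
      filter_upwards [gt_mem_nhds h] with r hr
      rw [radialProfile, if_pos (le_of_lt hr)]
    · rw [radialProfile, if_pos h.le, bumpProfile, min_eq_left h.le]; ring
  · refine ⟨-(2 * q) / (q ^ 2) ^ 2, ?_, ?_⟩
    · have h1 : HasDerivAt (fun q : ℝ => 1 / q ^ 2) (-(2 * q) / (q ^ 2) ^ 2) q := by
        simpa using (hasDerivAt_pow 2 q).fun_inv (by positivity)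
      refine h1.congr_of_eventuallyEq ?_
      filter_upwards [lt_mem_nhds h] with r hr
      rw [radialProfile_of_one_le (le_of_lt hr)]
    · rw [radialProfile_of_one_le h.le, bumpProfile_eq_zero h.le]
      field_simp; ring

/-- The square of the radial stretching factor. -/
noncomputable def stretchSq (l a t : ℝ) : ℝ :=
  (1 + a * (radialProfile (min t 1 / l) / l ^ 2)) / (1 + a)

/-- The radial stretching factor that carries the density `1 + a * bumpProfile (t / l) / l ^ 2` to
the constant density `1 + a` on the unit disc. -/
noncomputable def stretch (l a t : ℝ) : ℝ := √(stretchSq l a t)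

/-! ### Estimates for the radial stretching factor -/

section Stretch

variable {l a s t : ℝ}

theorem stretchSq_of_one_le (hl : 0 < l) (hl1 : l < 1) (ha : 0 ≤ a) (ht : 1 ≤ t) :
    stretchSq l a t = 1 := by
  rw [stretchSq, min_eq_right ht, radialProfile_of_one_le ((one_le_div hl).2 hl1.le)]
  have : 1 + a ≠ 0 := by positivity
  field_simp

theorem stretchSq_sub_bounds (hl : 0 < l) (ha : 0 ≤ a) (hs : 0 ≤ s) (hst : s ≤ t) :
    0 ≤ stretchSq l a s - stretchSq l a t ∧
    stretchSq l a s - stretchSq l a t ≤ a / (1 + a) * (2 / l ^ 3) * (min t 1 - min s 1) := by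
  have h := radialProfile_sub_bounds (s := min s 1 / l) (t := min t 1 / l) (by positivity)
    (by gcongr)
  have e : stretchSq l a s - stretchSq l a t = a / (1 + a) * (1 / l ^ 2) *
      (radialProfile (min s 1 / l) - radialProfile (min t 1 / l)) := by
    rw [stretchSq, stretchSq]; field_simp; ring
  rw [e]
  refine ⟨mul_nonneg (by positivity) h.1, ?_⟩
  calc _ ≤ a / (1 + a) * (1 / l ^ 2) * (2 * (min t 1 / l - min s 1 / l)) := by
        gcongr; exact h.2
    _ = _ := by field_simp

/-- The factor is nonincreasing and reaches `1` at `t = 1`, because the bump and the constant excess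
have the same total mass. Spreading a central bump pushes points outwards. -/
theorem one_le_stretchSq (hl : 0 < l) (hl1 : l < 1) (ha : 0 ≤ a) (ht : 0 ≤ t) :
    1 ≤ stretchSq l a t := by
  rcases le_total t 1 with h | h
  · have := (stretchSq_sub_bounds hl ha ht h).1
    rw [stretchSq_of_one_le hl hl1 ha le_rfl] at this
    linarith
  · exact (stretchSq_of_one_le hl hl1 ha h).ge

/-- This bound tends to `1` as `a → 0`, as the Lipschitz constant of the radial map requires. The
bound of `stretchSq_le_const` is uniform in `a` and serves the inverse map. -/
theorem stretchSq_le (hl : 0 < l) (ha : 0 ≤ a) :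
    stretchSq l a t ≤ 1 + a * (2 / l ^ 2) := by
  have h1 : 1 + a * (radialProfile (min t 1 / l) / l ^ 2) ≤ 1 + a * (2 / l ^ 2) := by
    gcongr; exact radialProfile_le_two
  rw [stretchSq, div_le_iff₀ (by positivity)]
  have : 0 ≤ (1 + a * (2 / l ^ 2)) * a := by positivity
  linarith

theorem stretchSq_le_const (hl : 0 < l) (hl1 : l < 1) (ha : 0 ≤ a) :
    stretchSq l a t ≤ 2 / l ^ 2 := by
  have h1 : 1 + a * (radialProfile (min t 1 / l) / l ^ 2) ≤ 1 + a * (2 / l ^ 2) := by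
    gcongr; exact radialProfile_le_two
  have h2 : 1 ≤ 2 / l ^ 2 := by
    rw [one_le_div (by positivity)]; nlinarith
  rw [stretchSq, div_le_iff₀ (by positivity)]
  nlinarith

theorem sq_stretch (hl : 0 < l) (hl1 : l < 1) (ha : 0 ≤ a) (ht : 0 ≤ t) :
    stretch l a t ^ 2 = stretchSq l a t :=
  Real.sq_sqrt (zero_le_one.trans (one_le_stretchSq hl hl1 ha ht))

theorem one_le_stretch (hl : 0 < l) (hl1 : l < 1) (ha : 0 ≤ a) (ht : 0 ≤ t) :
    1 ≤ stretch l a t := Real.one_le_sqrt.2 (one_le_stretchSq hl hl1 ha ht)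

theorem stretch_le_stretchSq (hl : 0 < l) (hl1 : l < 1) (ha : 0 ≤ a) (ht : 0 ≤ t) :
    stretch l a t ≤ stretchSq l a t := by
  have h1 := one_le_stretch hl hl1 ha ht
  rw [← sq_stretch hl hl1 ha ht]; nlinarith

theorem stretch_of_one_le (hl : 0 < l) (hl1 : l < 1) (ha : 0 ≤ a) (ht : 1 ≤ t) :
    stretch l a t = 1 := by
  rw [stretch, stretchSq_of_one_le hl hl1 ha ht, Real.sqrt_one]

theorem stretch_sub_bounds (hl : 0 < l) (hl1 : l < 1) (ha : 0 ≤ a) (hs : 0 ≤ s) (hst : s ≤ t) :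
    0 ≤ stretch l a s - stretch l a t ∧
    stretch l a s - stretch l a t ≤ a / (1 + a) * (1 / l ^ 3) * (min t 1 - min s 1) := by
  obtain ⟨h1, h2⟩ := stretchSq_sub_bounds hl ha hs hst
  have h3 := one_le_stretch hl hl1 ha hs
  have h4 := one_le_stretch hl hl1 ha (hs.trans hst)
  have h5 : a / (1 + a) * (2 / l ^ 3) * (min t 1 - min s 1)
      = 2 * (a / (1 + a) * (1 / l ^ 3) * (min t 1 - min s 1)) := by ring
  have h0 : 0 ≤ stretch l a s - stretch l a t := sub_nonneg.2 (Real.sqrt_le_sqrt (by linarith))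
  refine ⟨h0, ?_⟩
  rw [h5, ← sq_stretch hl hl1 ha hs, ← sq_stretch hl hl1 ha (hs.trans hst)] at h2
  -- The difference of squares is the difference times a sum of two factors that are each at least
  -- `1`.
  nlinarith

/-- The map `t ↦ t * stretch l a t` is the action on gauge values. On the unit interval, `(1 + a)`
times its square is `t ^ 2` plus a nondecreasing bump mass, so it increases at a rate at least of
order `1 / (1 + a)`. -/
theorem min_sub_min_le_mul_stretch (hl : 0 < l) (hl1 : l < 1) (ha : 0 ≤ a) (hs : 0 ≤ s)
    (hst : s ≤ t) : s * stretch l a s ≤ t * stretch l a t ∧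
    min t 1 - min s 1 ≤ (1 + a) * (2 / l ^ 2) * (t * stretch l a t - s * stretch l a s) := by
  have main : ∀ s t : ℝ, 0 ≤ s → s ≤ t → t ≤ 1 → s * stretch l a s ≤ t * stretch l a t ∧
      t - s ≤ (1 + a) * (2 / l ^ 2) * (t * stretch l a t - s * stretch l a s) := by
    intro s t hs hst ht1
    have ht := hs.trans hst
    have hS := one_le_stretch hl hl1 ha hs
    have hT := one_le_stretch hl hl1 ha ht
    have hsq : ∀ r, 0 ≤ r → r ≤ 1 → (1 + a) * (r * stretch l a r) ^ 2
        = r ^ 2 + a * ((r / l) ^ 2 * radialProfile (r / l)) := by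
      intro r hr hr1
      rw [mul_pow, sq_stretch hl hl1 ha hr, stretchSq, min_eq_left hr1]
      field_simp
    have hk := sq_mul_radialProfile_mono (s := s / l) (t := t / l) (by positivity) (by gcongr)
    have hdiff : t ^ 2 - s ^ 2 ≤
        (1 + a) * ((t * stretch l a t) ^ 2 - (s * stretch l a s) ^ 2) := by
      rw [mul_sub, hsq t ht ht1, hsq s hs (hst.trans ht1)]
      have := mul_le_mul_of_nonneg_left hk ha
      linarith
    have hle : s * stretch l a s ≤ t * stretch l a t := by
      refine (pow_le_pow_iff_left₀ (by positivity) (by positivity) two_ne_zero).1 ?_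
      have h1 : 0 ≤ t ^ 2 - s ^ 2 := by nlinarith
      have h2 := h1.trans hdiff
      have := nonneg_of_mul_nonneg_right h2 (by positivity)
      linarith
    refine ⟨hle, ?_⟩
    rcases (add_nonneg ht hs).eq_or_lt with h0 | h0
    · have hs0 : s = 0 := by linarith
      have ht0 : t = 0 := by linarith
      simp [hs0, ht0]
    · refine le_of_mul_le_mul_right ?_ h0
      have hsum : t * stretch l a t + s * stretch l a s ≤ 2 / l ^ 2 * (t + s) := by
        have h1 := (stretch_le_stretchSq hl hl1 ha ht).trans (stretchSq_le_const hl hl1 ha)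
        have h2 := (stretch_le_stretchSq hl hl1 ha hs).trans (stretchSq_le_const hl hl1 ha)
        nlinarith
      calc (t - s) * (t + s) = t ^ 2 - s ^ 2 := by ring
        _ ≤ (1 + a) * ((t * stretch l a t) ^ 2 - (s * stretch l a s) ^ 2) := hdiff
        _ = (1 + a) * (t * stretch l a t - s * stretch l a s)
            * (t * stretch l a t + s * stretch l a s) := by ring
        _ ≤ (1 + a) * (t * stretch l a t - s * stretch l a s) * (2 / l ^ 2 * (t + s)) := by
            have := sub_nonneg.2 hle
            gcongr
        _ = _ := by ring
  rcases le_total t 1 with ht | ht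
  · rw [min_eq_left ht, min_eq_left (hst.trans ht)]
    exact main s t hs hst ht
  · rw [min_eq_right ht, stretch_of_one_le hl hl1 ha ht]
    rcases le_total s 1 with hs1 | hs1
    · have h := main s 1 hs hs1 le_rfl
      rw [stretch_of_one_le hl hl1 ha le_rfl] at h
      rw [min_eq_left hs1]
      refine ⟨by linarith [h.1], h.2.trans ?_⟩
      gcongr
    · rw [min_eq_right hs1, stretch_of_one_le hl hl1 ha hs1]
      refine ⟨by linarith, ?_⟩
      have : 0 ≤ t * 1 - s * 1 := by linarith
      rw [sub_self]; positivity

theorem continuousOn_stretch (hl : 0 < l) (hl1 : l < 1) (ha : 0 ≤ a) :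
    ContinuousOn (stretch l a) (Ici 0) := by
  have : LipschitzOnWith (a / (1 + a) * (1 / l ^ 3)).toNNReal (stretch l a) (Ici 0) := by
    refine LipschitzOnWith.of_dist_le' fun s hs t ht => ?_
    wlog hst : s ≤ t generalizing s t with H
    · rw [dist_comm, dist_comm s]; exact H t ht s hs (le_of_not_ge hst)
    obtain ⟨h1, h2⟩ := stretch_sub_bounds hl hl1 ha hs hst
    rw [Real.dist_eq, Real.dist_eq, abs_of_nonneg h1, abs_sub_comm, abs_of_nonneg (sub_nonneg.2 hst)]
    refine h2.trans ?_
    refine mul_le_mul_of_nonneg_left ?_ (by positivity)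
    rcases le_total s 1 with h | h
    · rw [min_eq_left h]; linarith [min_le_left t 1]
    · rw [min_eq_right h, min_eq_right (h.trans hst)]; linarith
  exact this.continuousOn

/-- The displayed identity is the derivative of the mass balance for `(1 + a) * (t * stretch l a t)
^ 2`, divided by `2 * t`. It is the Jacobian equation of the radial map. -/
theorem exists_hasDerivAt_stretch (hl : 0 < l) (hl1 : l < 1) (ha : 0 ≤ a) (ht : 0 < t)
    (htl : t ≠ l) (ht1 : t < 1) : ∃ k, HasDerivAt (stretch l a) k t ∧
      (1 + a) * (stretch l a t ^ 2 + stretch l a t * (k * t))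
        = 1 + a * (bumpProfile (t / l) / l ^ 2) := by
  obtain ⟨k, hk, hkb⟩ := exists_hasDerivAt_radialProfile (q := t / l) (by positivity)
    (by rw [Ne, div_eq_one_iff_eq hl.ne']; exact htl)
  have hW : HasDerivAt (stretchSq l a) (a * (k * (1 / l) / l ^ 2) / (1 + a)) t := by
    have h1 : HasDerivAt (fun t => (1 + a * (radialProfile (t / l) / l ^ 2)) / (1 + a))
        (a * (k * (1 / l) / l ^ 2) / (1 + a)) t :=
      (((((hk.comp t ((hasDerivAt_id t).div_const l)).div_const _).const_mul a).const_add
        1).div_const _)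
    refine h1.congr_of_eventuallyEq ?_
    filter_upwards [gt_mem_nhds ht1] with r hr
    rw [stretchSq, min_eq_left (le_of_lt hr)]
  have hpos := one_le_stretchSq hl hl1 ha ht.le
  have hsp := one_le_stretch hl hl1 ha ht.le
  refine ⟨_, hW.sqrt (by linarith), ?_⟩
  rw [← stretch, sq_stretch hl hl1 ha ht.le, ← hkb, stretchSq, min_eq_left ht1.le]
  have : stretch l a t ≠ 0 := by linarith
  field_simp
  ring

end Stretch

/-! ### The radial map is biLipschitz and has the required Jacobian -/

section RadialMap

variable {g : Plane → ℝ} {p : Plane} {K R l a : ℝ}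

/-- The radial map about `p` with stretching factor `stretch l a (g y)` at `y`. -/
noncomputable def radialMap (g : Plane → ℝ) (p : Plane) (l a : ℝ) (y : Plane) : Plane :=
  p + stretch l a (g y) • (y - p)

theorem gauge_radialMap (hg : IsRadialGauge g p K R) (hl : 0 < l) (hl1 : l < 1) (ha : 0 ≤ a)
    (y : Plane) : g (radialMap g p l a y) = g y * stretch l a (g y) := by
  rw [radialMap, hg.hom _ (zero_le_one.trans (one_le_stretch hl hl1 ha (hg.nonneg y))),
    add_sub_cancel, mul_comm]

theorem radialMap_of_one_le (hl : 0 < l) (hl1 : l < 1) (ha : 0 ≤ a) {y : Plane} (hy : 1 ≤ g y) :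
    radialMap g p l a y = y := by
  rw [radialMap, stretch_of_one_le hl hl1 ha hy]; simp

theorem dist_radialMap_le (hg : IsRadialGauge g p K R) (hl : 0 < l) (hl1 : l < 1) (ha : 0 ≤ a)
    (x y : Plane) : dist (radialMap g p l a x) (radialMap g p l a y)
      ≤ (1 + (2 / l ^ 2 + R * K / l ^ 3) * a) * dist x y := by
  wlog hxy : g y ≤ g x generalizing x y with H
  · rw [dist_comm, dist_comm x]; exact H y x (le_of_not_ge hxy)
  have hR := hg.nonneg_right
  have hK := hg.nonneg_left
  have e : radialMap g p l a x - radialMap g p l a y = stretch l a (g x) • (x - y)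
      - (stretch l a (g y) - stretch l a (g x)) • (y - p) := by
    rw [radialMap, radialMap]; module
  obtain ⟨h0, h1⟩ := stretch_sub_bounds hl hl1 ha (hg.nonneg y) hxy
  have hw := (stretch_le_stretchSq hl hl1 ha (hg.nonneg x)).trans (stretchSq_le hl ha)
  have hw0 := zero_le_one.trans (one_le_stretch hl hl1 ha (hg.nonneg x))
  have hsecond : (stretch l a (g y) - stretch l a (g x)) * dist y p
      ≤ a * (1 / l ^ 3) * (K * dist x y) * R := by
    rcases le_total (g y) 1 with hy | hy
    · have hmin : min (g x) 1 - min (g y) 1 ≤ K * dist x y := by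
        rw [min_eq_left hy]
        linarith [min_le_left (g x) 1, le_abs_self (g x - g y), hg.lip x y]
      have hmin0 : 0 ≤ min (g x) 1 - min (g y) 1 := sub_nonneg.2 (min_le_min_right 1 hxy)
      have hdp : dist y p ≤ R := (hg.dist_le y).trans (by nlinarith)
      have ha1 : a / (1 + a) ≤ a := div_le_self ha (by linarith)
      calc _ ≤ a / (1 + a) * (1 / l ^ 3) * (min (g x) 1 - min (g y) 1) * R := by gcongr
        _ ≤ _ := by gcongr
    · rw [stretch_of_one_le hl hl1 ha hy, stretch_of_one_le hl hl1 ha (hy.trans hxy), sub_self,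
        zero_mul]
      positivity
  calc dist (radialMap g p l a x) (radialMap g p l a y)
      ≤ ‖stretch l a (g x) • (x - y)‖ + ‖(stretch l a (g y) - stretch l a (g x)) • (y - p)‖ := by
        rw [dist_eq_norm, e]; exact norm_sub_le _ _
    _ = stretch l a (g x) * dist x y + (stretch l a (g y) - stretch l a (g x)) * dist y p := by
        rw [norm_smul, norm_smul, Real.norm_of_nonneg hw0, Real.norm_of_nonneg h0, dist_eq_norm,
          dist_eq_norm]
    _ ≤ (1 + a * (2 / l ^ 2)) * dist x y + a * (1 / l ^ 3) * (K * dist x y) * R := by gcongr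
    _ = _ := by ring

theorem dist_le_dist_radialMap (hg : IsRadialGauge g p K R) (hl : 0 < l) (hl1 : l < 1)
    (ha : 0 ≤ a) (x y : Plane) : dist x y
      ≤ (1 + 2 * R * K / l ^ 5 * a) * dist (radialMap g p l a x) (radialMap g p l a y) := by
  wlog hxy : g y ≤ g x generalizing x y with H
  · rw [dist_comm, dist_comm (radialMap g p l a x)]; exact H y x (le_of_not_ge hxy)
  have hR := hg.nonneg_right
  have hK := hg.nonneg_left
  set X := radialMap g p l a x with hX
  set Y := radialMap g p l a y with hY
  set wx := stretch l a (g x) with hwx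
  set wy := stretch l a (g y) with hwy
  have hx1 : 1 ≤ wx := one_le_stretch hl hl1 ha (hg.nonneg x)
  have hy1 : 1 ≤ wy := one_le_stretch hl hl1 ha (hg.nonneg y)
  have ex : X - p = wx • (x - p) := by rw [hX, radialMap, add_sub_cancel_left]
  have ey : Y - p = wy • (y - p) := by rw [hY, radialMap, add_sub_cancel_left]
  have e : x - y = wx⁻¹ • (X - Y) - (wy⁻¹ - wx⁻¹) • (Y - p) := by
    have h1 : x - p = wx⁻¹ • (X - p) := by rw [ex, inv_smul_smul₀ (by linarith)]
    have h2 : y - p = wy⁻¹ • (Y - p) := by rw [ey, inv_smul_smul₀ (by linarith)]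
    rw [← sub_sub_sub_cancel_right x y p, h1, h2]; module
  obtain ⟨h0, h1⟩ := stretch_sub_bounds hl hl1 ha (hg.nonneg y) hxy
  obtain ⟨h2, h3⟩ := min_sub_min_le_mul_stretch hl hl1 ha (hg.nonneg y) hxy
  have hinv : |wy⁻¹ - wx⁻¹| ≤ wy - wx := by
    rw [inv_sub_inv (by linarith) (by linarith), abs_div, abs_sub_comm, abs_of_nonneg h0,
      abs_of_pos (by positivity)]
    exact div_le_self h0 (by nlinarith)
  have hgX : g X = g x * wx := gauge_radialMap hg hl hl1 ha x
  have hgY : g Y = g y * wy := gauge_radialMap hg hl hl1 ha y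
  have hsecond : |wy⁻¹ - wx⁻¹| * dist Y p
      ≤ a * (1 / l ^ 3) * (2 / l ^ 2 * (K * dist X Y)) * R := by
    rcases le_total (g y) 1 with hy | hy
    · have hYp : dist Y p ≤ R := by
        have hle : g Y ≤ 1 := by
          have := (min_sub_min_le_mul_stretch hl hl1 ha (hg.nonneg y) hy).1
          rw [stretch_of_one_le hl hl1 ha le_rfl] at this
          rw [hgY]; linarith
        exact (hg.dist_le Y).trans (by nlinarith)
      have hgd : g x * wx - g y * wy ≤ K * dist X Y := by
        rw [← hgX, ← hgY]; exact (le_abs_self _).trans (hg.lip _ _)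
      calc |wy⁻¹ - wx⁻¹| * dist Y p
          ≤ (a / (1 + a) * (1 / l ^ 3) * (min (g x) 1 - min (g y) 1)) * R :=
            mul_le_mul (hinv.trans h1) hYp dist_nonneg ((abs_nonneg _).trans (hinv.trans h1))
        -- The factor `1 + a` lost by inverting the gauge action cancels against `a / (1 + a)` from
        -- the variation of the stretch. The estimate therefore stays linear in `a`.
        _ ≤ (a / (1 + a) * (1 / l ^ 3) *
              ((1 + a) * (2 / l ^ 2) * (K * dist X Y))) * R := by
            gcongr
            exact h3.trans (by gcongr)
        _ = _ := by field_simp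
    · have hx := hy.trans hxy
      rw [hwx, hwy, stretch_of_one_le hl hl1 ha hy, stretch_of_one_le hl hl1 ha hx, sub_self,
        abs_zero, zero_mul]
      positivity
  calc dist x y ≤ ‖wx⁻¹ • (X - Y)‖ + ‖(wy⁻¹ - wx⁻¹) • (Y - p)‖ := by
        rw [dist_eq_norm, e]; exact norm_sub_le _ _
    _ = wx⁻¹ * dist X Y + |wy⁻¹ - wx⁻¹| * dist Y p := by
        rw [norm_smul, norm_smul, Real.norm_of_nonneg (by positivity), Real.norm_eq_abs,
          dist_eq_norm, dist_eq_norm]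
    _ ≤ 1 * dist X Y + a * (1 / l ^ 3) * (2 / l ^ 2 * (K * dist X Y)) * R := by
        gcongr; exact inv_le_one_of_one_le₀ hx1
    _ = _ := by ring

/-- The map preserves rays, so it suffices to solve `t * stretch l a t = g x` by the intermediate
value theorem. -/
theorem radialMap_surjective (hg : IsRadialGauge g p K R) (hl : 0 < l) (hl1 : l < 1)
    (ha : 0 ≤ a) : Function.Surjective (radialMap g p l a) := by
  intro x
  have hx0 := hg.nonneg x
  have hT : (0 : ℝ) ≤ max (g x) 1 := le_max_of_le_right zero_le_one
  have hcont : ContinuousOn (fun t => t * stretch l a t) (Icc 0 (max (g x) 1)) :=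
    continuousOn_id.mul ((continuousOn_stretch hl hl1 ha).mono Icc_subset_Ici_self)
  obtain ⟨t, ht, hts⟩ := intermediate_value_Icc hT hcont
    (show g x ∈ Icc _ _ by
      simp only [zero_mul]
      rw [stretch_of_one_le hl hl1 ha (le_max_right _ _), mul_one]
      exact ⟨hx0, le_max_left _ _⟩)
  have hw := one_le_stretch hl hl1 ha ht.1
  have hgy : g (p + (stretch l a t)⁻¹ • (x - p)) = t := by
    rw [hg.hom _ (by positivity), add_sub_cancel, ← hts]
    field_simp
  refine ⟨p + (stretch l a t)⁻¹ • (x - p), ?_⟩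
  rw [radialMap, hgy, add_sub_cancel_left, smul_inv_smul₀ (by linarith), add_sub_cancel]

theorem exists_transportable_radial (hg : IsRadialGauge g p K R) (hl : 0 < l) (hl1 : l < 1) :
    ∃ C : ℝ, 0 ≤ C ∧ ∀ a : ℝ, 0 ≤ a → ∀ ρ ρ' : Plane → ℝ, (∀ x, g x < 1 → ρ x = 1 + a) →
      (∀ x, g x < 1 → ρ' x = 1 + a * (bumpProfile (g x / l) / l ^ 2)) →
      (∀ x, 1 < g x → ρ x = ρ' x) → Transportable {x | g x < 1} (1 + C * a) ρ' ρ := by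
  have hR := hg.nonneg_right
  have hK := hg.nonneg_left
  refine ⟨2 / l ^ 2 + R * K / l ^ 3 + 2 * R * K / l ^ 5, by positivity,
    fun a ha ρ ρ' hρ hρ' hoff => ?_⟩
  have hinj : Function.Injective (radialMap g p l a) := fun x y hxy => by
    have := dist_le_dist_radialMap hg hl hl1 ha x y
    rw [hxy, dist_self, mul_zero] at this
    exact dist_le_zero.1 this
  refine ⟨Equiv.ofBijective _ ⟨hinj, radialMap_surjective hg hl hl1 ha⟩, fun x y => ?_,
    fun x y => ?_, fun x hx => ?_, ?_⟩
  · refine (dist_radialMap_le hg hl hl1 ha x y).trans ?_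
    refine mul_le_mul_of_nonneg_right ?_ dist_nonneg
    have : 0 ≤ 2 * R * K / l ^ 5 * a := by positivity
    linarith
  · set e := Equiv.ofBijective _ ⟨hinj, radialMap_surjective hg hl hl1 ha⟩
    have h := dist_le_dist_radialMap hg hl hl1 ha (e.symm x) (e.symm y)
    change _ ≤ _ * dist (e (e.symm x)) (e (e.symm y)) at h
    rw [e.apply_symm_apply, e.apply_symm_apply] at h
    refine h.trans ?_
    refine mul_le_mul_of_nonneg_right ?_ dist_nonneg
    have : 0 ≤ (2 / l ^ 2 + R * K / l ^ 3) * a := by positivity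
    linarith
  · exact radialMap_of_one_le hl hl1 ha (not_lt.1 hx)
  -- The formulas for the stretch change at the levels `1` and `l`; these are null and can be
  -- discarded, as can the centre.
  have hne1 : ∀ᵐ y, g y ≠ 1 := by
    rw [ae_iff]; simpa using hg.volume_level_eq_zero one_pos
  have hnel : ∀ᵐ y, g y ≠ l := by
    rw [ae_iff]; simpa using hg.volume_level_eq_zero hl
  have hnep : ∀ᵐ y : Plane, y ≠ p := Measure.ae_ne volume p
  filter_upwards [hg.lipschitzWith.ae_differentiableAt, hne1, hnel, hnep] with y hd h1 hl' hp
  change DifferentiableAt ℝ (radialMap g p l a) y ∧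
    (fderiv ℝ (radialMap g p l a) y).det * ρ (radialMap g p l a y) = ρ' y
  rcases h1.lt_or_gt with h1 | h1
  · obtain ⟨k, hk, hkb⟩ := exists_hasDerivAt_stretch hl hl1 ha (hg.pos hp) hl' h1
    have hF : HasFDerivAt (radialMap g p l a)
        (stretch l a (g y) • ContinuousLinearMap.id ℝ Plane
          + (k • fderiv ℝ g y).smulRight (y - p)) y := by
      exact ((hk.comp_hasFDerivAt y hd.hasFDerivAt).smul
        ((hasFDerivAt_id y).sub_const p)).const_add p
    refine ⟨hF.differentiableAt, ?_⟩
    have hlt : g (radialMap g p l a y) < 1 := by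
      rw [gauge_radialMap hg hl hl1 ha]
      obtain ⟨hle, hmin⟩ := min_sub_min_le_mul_stretch hl hl1 ha (hg.nonneg y) h1.le
      rw [stretch_of_one_le hl hl1 ha le_rfl, min_eq_left h1.le, min_self] at hmin
      rw [stretch_of_one_le hl hl1 ha le_rfl] at hle
      refine lt_of_le_of_ne (by linarith) fun heq => ?_
      rw [heq] at hmin
      linarith
    rw [hF.fderiv, det_smul_id_add_smulRight, hρ _ hlt, hρ' y h1, ← hkb]
    simp only [smul_apply, hg.fderiv_apply_sub hd, smul_eq_mul]
    ring
  · have hid : radialMap g p l a =ᶠ[nhds y] id := by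
      filter_upwards [hg.continuous.continuousAt.eventually_mem (lt_mem_nhds h1)] with z hz
      exact radialMap_of_one_le hl hl1 ha (le_of_lt hz)
    refine ⟨differentiableAt_id.congr_of_eventuallyEq hid, ?_⟩
    rw [hid.fderiv_eq, radialMap_of_one_le hl hl1 ha h1.le, hoff y h1]
    simp [ContinuousLinearMap.det]

end RadialMap

/-! ### Rearrangement along parallel lines -/

/-- Two intervals are allowed because two parallel lines meet a ball in parameter intervals with
different centres, each of length at most `2 * r`. -/
theorem abs_setIntegral_le_of_indicator {F : ℝ → ℝ} (hF : Integrable F) (S : Set ℝ)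
    {a b r M : ℝ} (hr : 0 ≤ r)
    (hb : ∀ s, |F s| ≤ (Icc (a - r) (a + r)).indicator (fun _ => M) s
      + (Icc (b - r) (b + r)).indicator (fun _ => M) s) :
    |∫ s in S, F s| ≤ 4 * r * M := by
  have hi : ∀ c : ℝ, Integrable ((Icc (c - r) (c + r)).indicator fun _ => M) := fun c =>
    (integrable_indicator_iff measurableSet_Icc).2 (integrableOn_const (by simp))
  have hv : ∀ c : ℝ, ∫ s, (Icc (c - r) (c + r)).indicator (fun _ => M) s = 2 * r * M := fun c => by
    rw [integral_indicator measurableSet_Icc, setIntegral_const, smul_eq_mul, Real.volume_real_Icc,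
      show c + r - (c - r) = 2 * r by ring, max_eq_left (by positivity)]
  calc |∫ s in S, F s| ≤ ∫ s in S, |F s| := abs_integral_le_integral_abs
    _ ≤ ∫ s, |F s| := setIntegral_le_integral hF.abs (Filter.Eventually.of_forall fun _ =>
        abs_nonneg _)
    _ ≤ ∫ s, ((Icc (a - r) (a + r)).indicator (fun _ => M) s
      + (Icc (b - r) (b + r)).indicator (fun _ => M) s) :=
        integral_mono hF.abs ((hi a).add (hi b)) hb
    _ = _ := by rw [integral_add (hi a) (hi b), hv, hv]; ring

theorem mem_Icc_inner_of_mem_closedBall {e x z : Plane} (he : ‖e‖ = 1) {s r : ℝ}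
    (h : x + s • e ∈ Metric.closedBall z r) :
    s ∈ Icc (inner ℝ (z - x) e - r) (inner ℝ (z - x) e + r) := by
  rw [Metric.mem_closedBall, dist_eq_norm] at h
  have h1 : |inner ℝ (x + s • e - z) e| ≤ r :=
    (abs_real_inner_le_norm _ _).trans (by rw [he, mul_one]; exact h)
  have h2 : inner ℝ (x + s • e - z) e = s - inner ℝ (z - x) e := by
    rw [show x + s • e - z = s • e - (z - x) by abel, inner_sub_left, real_inner_smul_left,
      real_inner_self_eq_norm_sq, he]; ring
  rw [h2, abs_le] at h1
  constructor <;> linarith [h1.1, h1.2]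

theorem continuous_of_abs_sub_le {F : Plane → ℝ} {A : ℝ}
    (h : ∀ x y, |F x - F y| ≤ A * dist x y) : Continuous F :=
  (LipschitzWith.of_dist_le' (K := A) fun x y => by rw [Real.dist_eq]; exact h x y).continuous

/-- The restriction to a line of a continuous function supported in a ball is integrable. -/
theorem integrable_line {D : Plane → ℝ} (hD : Continuous D) {e z : Plane} (he : ‖e‖ = 1)
    {r : ℝ} (h0 : ∀ x ∉ Metric.closedBall z r, D x = 0) (x : Plane) :
    Integrable fun s : ℝ => D (x + s • e) := by
  refine Continuous.integrable_of_hasCompactSupport (by fun_prop) ?_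
  refine HasCompactSupport.intro (isCompact_Icc (a := inner ℝ (z - x) e - r)
    (b := inner ℝ (z - x) e + r)) fun s hs => h0 _ fun hm => hs ?_
  exact mem_Icc_inner_of_mem_closedBall he hm

theorem abs_lineIntegral_le {D : Plane → ℝ} (hD : Continuous D) {e z : Plane} (he : ‖e‖ = 1)
    {r B : ℝ} (hr : 0 ≤ r) (h0 : ∀ x ∉ Metric.closedBall z r, D x = 0) (hB : ∀ x, |D x| ≤ B)
    (S : Set ℝ) (x : Plane) : |∫ s in S, D (x + s • e)| ≤ 4 * r * B := by
  have hB0 : 0 ≤ B := (abs_nonneg _).trans (hB x)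
  refine abs_setIntegral_le_of_indicator (integrable_line hD he h0 x) _
    (a := inner ℝ (z - x) e) (b := inner ℝ (z - x) e) hr fun s => ?_
  have hnn := indicator_nonneg (s := Icc (inner ℝ (z - x) e - r) (inner ℝ (z - x) e + r))
    (f := fun _ => B) (fun _ _ => hB0) s
  by_cases hs : x + s • e ∈ Metric.closedBall z r
  · rw [indicator_of_mem (mem_Icc_inner_of_mem_closedBall he hs)]
    exact (hB _).trans (le_add_of_nonneg_right hB0)
  · rw [h0 _ hs, abs_zero]
    exact add_nonneg hnn hnn

theorem abs_lineIntegral_sub_le {D : Plane → ℝ} {M : ℝ} (hD : ∀ x y, |D x - D y| ≤ M * dist x y)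
    {e z : Plane} (he : ‖e‖ = 1) {r : ℝ} (hr : 0 ≤ r)
    (h0 : ∀ x ∉ Metric.closedBall z r, D x = 0) (S : Set ℝ) (x y : Plane) :
    |(∫ s in S, D (x + s • e)) - ∫ s in S, D (y + s • e)| ≤ 4 * r * M * dist x y := by
  have hM : 0 ≤ M * dist x y := (abs_nonneg _).trans (hD x y)
  have hc := continuous_of_abs_sub_le hD
  have hi := integrable_line hc he h0
  rw [← integral_sub (hi x).integrableOn (hi y).integrableOn]
  refine (abs_setIntegral_le_of_indicator ((hi x).sub (hi y)) _ (a := inner ℝ (z - x) e)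
    (b := inner ℝ (z - y) e) (M := M * dist x y) hr fun s => ?_).trans (le_of_eq (by ring))
  have hbound : |D (x + s • e) - D (y + s • e)| ≤ M * dist x y := by
    have h1 := hD (x + s • e) (y + s • e)
    rwa [dist_add_right] at h1
  have hnn := fun c => indicator_nonneg (s := Icc (inner ℝ (z - c) e - r) (inner ℝ (z - c) e + r))
    (f := fun _ => M * dist x y) (fun _ _ => hM) s
  by_cases hx : x + s • e ∈ Metric.closedBall z r
  · rw [indicator_of_mem (mem_Icc_inner_of_mem_closedBall he hx)]
    exact hbound.trans (le_add_of_nonneg_right (hnn y))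
  by_cases hy : y + s • e ∈ Metric.closedBall z r
  · rw [indicator_of_mem (mem_Icc_inner_of_mem_closedBall he hy)
      (f := fun _ => M * dist x y)]
    exact hbound.trans (le_add_of_nonneg_left (hnn x))
  · rw [Pi.sub_apply, h0 _ hx, h0 _ hy, sub_self, abs_zero]
    exact add_nonneg (hnn x) (hnn y)

/-- Two Lipschitz densities that agree off a bounded convex set and have the same integral along
every line of direction `e`. -/
structure FiberPair (e : Plane) (ρ ρ' : Plane → ℝ) (Q : Set Plane) (z : Plane) (r A B : ℝ) :
    Prop where
  norm_eq : ‖e‖ = 1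
  one_le : ∀ x, 1 ≤ ρ x
  one_le' : ∀ x, 1 ≤ ρ' x
  lip : ∀ x y, |ρ x - ρ y| ≤ A * dist x y
  lip' : ∀ x y, |ρ' x - ρ' y| ≤ A * dist x y
  convex : Convex ℝ Q
  subset : Q ⊆ Metric.closedBall z r
  radius_nonneg : 0 ≤ r
  eq_off : ∀ x ∉ Q, ρ x = ρ' x
  abs_sub_le : ∀ x, |ρ x - ρ' x| ≤ B
  integral_eq : ∀ x, ∫ s : ℝ, (ρ (x + s • e) - ρ' (x + s • e)) = 0

/-- The excess of `ρ` over `ρ'` on the half-line that ends at `x` in direction `e`. -/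
noncomputable def fiberExcess (e : Plane) (ρ ρ' : Plane → ℝ) (x : Plane) : ℝ :=
  ∫ s in Iic (0 : ℝ), (ρ (x + s • e) - ρ' (x + s • e))

namespace FiberPair

variable {e z : Plane} {ρ ρ' : Plane → ℝ} {Q : Set Plane} {r A B : ℝ}

theorem symm (h : FiberPair e ρ ρ' Q z r A B) : FiberPair e ρ' ρ Q z r A B where
  norm_eq := h.norm_eq
  one_le := h.one_le'
  one_le' := h.one_le
  lip := h.lip'
  lip' := h.lip
  convex := h.convex
  subset := h.subset
  radius_nonneg := h.radius_nonneg
  eq_off x hx := (h.eq_off x hx).symm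
  abs_sub_le x := by rw [abs_sub_comm]; exact h.abs_sub_le x
  integral_eq x := by
    rw [← neg_zero, ← h.integral_eq x, ← integral_neg]
    simp only [neg_sub]

theorem fiberExcess_symm (x : Plane) : fiberExcess e ρ' ρ x = -fiberExcess e ρ ρ' x := by
  rw [fiberExcess, fiberExcess, ← integral_neg]
  simp only [neg_sub]

theorem continuous (h : FiberPair e ρ ρ' Q z r A B) : Continuous ρ :=
  continuous_of_abs_sub_le h.lip

theorem integrable (h : FiberPair e ρ ρ' Q z r A B) (x : Plane) :
    Integrable fun s : ℝ => ρ (x + s • e) - ρ' (x + s • e) :=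
  integrable_line (D := fun x => ρ x - ρ' x) (h.continuous.sub h.symm.continuous) h.norm_eq
    (fun x hx => sub_eq_zero.2 (h.eq_off x fun hx' => hx (h.subset hx'))) x

theorem abs_fiberExcess_le (h : FiberPair e ρ ρ' Q z r A B) (x : Plane) :
    |fiberExcess e ρ ρ' x| ≤ 4 * r * B :=
  abs_lineIntegral_le (D := fun x => ρ x - ρ' x) (h.continuous.sub h.symm.continuous) h.norm_eq
    h.radius_nonneg (fun x hx => sub_eq_zero.2 (h.eq_off x fun hx' => hx (h.subset hx')))
    h.abs_sub_le _ x

theorem nonneg_lip (h : FiberPair e ρ ρ' Q z r A B) : 0 ≤ A := by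
  have h1 := (abs_nonneg _).trans (h.lip e 0)
  rwa [dist_zero_right, h.norm_eq, mul_one] at h1

theorem abs_fiberExcess_sub_le (h : FiberPair e ρ ρ' Q z r A B) (x y : Plane) :
    |fiberExcess e ρ ρ' x - fiberExcess e ρ ρ' y| ≤ 8 * r * A * dist x y := by
  refine (abs_lineIntegral_sub_le (D := fun x => ρ x - ρ' x) (M := 2 * A) (fun x y => ?_)
    h.norm_eq h.radius_nonneg
    (fun x hx => sub_eq_zero.2 (h.eq_off x fun hx' => hx (h.subset hx'))) _ x y).trans
    (le_of_eq (by ring))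
  calc _ = |(ρ x - ρ y) - (ρ' x - ρ' y)| := by congr 1; ring
    _ ≤ _ := (abs_sub _ _).trans (by linarith [h.lip x y, h.lip' x y])

/-- The masses of `ρ` and `ρ'` on a half-line are infinite; their difference is finite and changes
along the line by the mass difference in between. -/
theorem fiberExcess_add_smul (h : FiberPair e ρ ρ' Q z r A B) (x : Plane) (t : ℝ) :
    fiberExcess e ρ ρ' (x + t • e) = fiberExcess e ρ ρ' x
      + ((∫ s in (0 : ℝ)..t, ρ (x + s • e)) - ∫ s in (0 : ℝ)..t, ρ' (x + s • e)) := by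
  have hc := h.continuous
  have hc' := h.symm.continuous
  have h1 : fiberExcess e ρ ρ' (x + t • e)
      = ∫ s in Iic t, (ρ (x + s • e) - ρ' (x + s • e)) := by
    rw [fiberExcess, ← integral_indicator measurableSet_Iic, ← integral_indicator measurableSet_Iic,
      ← integral_add_right_eq_self
        ((Iic t).indicator fun s => ρ (x + s • e) - ρ' (x + s • e)) t]
    congr 1
    ext s
    simp only [indicator, mem_Iic]
    rw [show x + t • e + s • e = x + (s + t) • e by module]
    simp
  rw [h1, fiberExcess, ← intervalIntegral.integral_sub
      (Continuous.intervalIntegrable (by fun_prop) _ _)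
      (Continuous.intervalIntegrable (by fun_prop) _ _),
    ← intervalIntegral.integral_Iic_sub_Iic (h.integrable x).integrableOn
      (h.integrable x).integrableOn]
  ring

theorem fiberExcess_eq_zero (h : FiberPair e ρ ρ' Q z r A B) {x : Plane} (hx : x ∉ Q) :
    fiberExcess e ρ ρ' x = 0 := by
  -- If the line meets `Q` behind `x`, convexity keeps it out of `Q` ahead of `x`, and the half-line
  -- carries the whole integral, which is zero. Otherwise the integrand vanishes behind `x`.
  by_cases hneg : ∃ s : ℝ, s ≤ 0 ∧ x + s • e ∈ Q
  · obtain ⟨s, hs, hsQ⟩ := hneg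
    have hpos : ∀ t : ℝ, 0 < t → ρ (x + t • e) - ρ' (x + t • e) = 0 := by
      intro t ht
      refine sub_eq_zero.2 (h.eq_off _ fun htQ => hx ?_)
      have hst : 0 < t - s := by linarith
      have := h.convex hsQ htQ (a := t / (t - s)) (b := -s / (t - s)) (by positivity)
        (div_nonneg (by linarith) hst.le) (by field_simp; ring)
      convert this using 1
      have h2 : (t / (t - s)) • (x + s • e) + (-s / (t - s)) • (x + t • e)
          = (t / (t - s) + -s / (t - s)) • x
            + (t / (t - s) * s + -s / (t - s) * t) • e := by module
      rw [h2, show t / (t - s) + -s / (t - s) = 1 by field_simp; ring,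
        show t / (t - s) * s + -s / (t - s) * t = 0 by field_simp; ring]
      simp
    rw [← h.integral_eq x, fiberExcess]
    refine setIntegral_eq_integral_of_forall_compl_eq_zero fun t ht => hpos t ?_
    simpa using ht
  · push Not at hneg
    rw [fiberExcess, setIntegral_congr_fun measurableSet_Iic (g := fun _ => (0 : ℝ))]
    · simp
    · exact fun s hs => sub_eq_zero.2 (h.eq_off _ (hneg s hs))

theorem abs_sub_le_abs_integral (h : FiberPair e ρ ρ' Q z r A B) (x : Plane) (c d : ℝ) :
    |c - d| ≤ |(∫ s in (0 : ℝ)..c, ρ' (x + s • e)) - ∫ s in (0 : ℝ)..d, ρ' (x + s • e)| := by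
  have hc' := h.symm.continuous
  have hi : ∀ a b : ℝ, IntervalIntegrable (fun s : ℝ => ρ' (x + s • e)) volume a b := fun a b =>
    Continuous.intervalIntegrable (by fun_prop) _ _
  wlog hcd : d ≤ c generalizing c d with H
  · rw [abs_sub_comm, abs_sub_comm (∫ s in (0 : ℝ)..c, _)]; exact H d c (le_of_not_ge hcd)
  rw [intervalIntegral.integral_interval_sub_left (hi _ _) (hi _ _), abs_of_nonneg (by linarith)]
  refine le_trans ?_ (le_abs_self _)
  have := intervalIntegral.integral_mono_on hcd (f := fun _ => (1 : ℝ)) (by simp) (hi d c)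
    (fun s _ => h.one_le' _)
  simpa using this

/-- Moving `x` by `d` along `e` equalizes the mass of `ρ` behind `x` and the mass of `ρ'` behind the
image: this is monotone rearrangement on the line. A solution exists because `ρ' ≥ 1` makes the
primitive grow at least linearly. -/
theorem exists_shift (h : FiberPair e ρ ρ' Q z r A B) (x : Plane) :
    ∃ d : ℝ, ∫ s in (0 : ℝ)..d, ρ' (x + s • e) = fiberExcess e ρ ρ' x := by
  have hc' := h.symm.continuous
  set E := fiberExcess e ρ ρ' x
  have hcont : Continuous fun d : ℝ => ∫ s in (0 : ℝ)..d, ρ' (x + s • e) :=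
    intervalIntegral.continuous_primitive
      (fun a b => Continuous.intervalIntegrable (by fun_prop) _ _) 0
  have hi : ∀ a b : ℝ, IntervalIntegrable (fun s : ℝ => ρ' (x + s • e)) volume a b := fun a b =>
    Continuous.intervalIntegrable (by fun_prop) _ _
  have hup : |E| ≤ ∫ s in (0 : ℝ)..|E|, ρ' (x + s • e) := by
    have := intervalIntegral.integral_mono_on (abs_nonneg E) (f := fun _ => (1 : ℝ)) (by simp)
      (hi 0 |E|) (fun s _ => h.one_le' _)
    simpa using this
  have hlow : ∫ s in (0 : ℝ)..(-|E|), ρ' (x + s • e) ≤ -|E| := by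
    rw [intervalIntegral.integral_symm]
    have := intervalIntegral.integral_mono_on (neg_nonpos.2 (abs_nonneg E))
      (f := fun _ => (1 : ℝ)) (by simp) (hi (-|E|) 0) (fun s _ => h.one_le' _)
    simpa using this
  obtain ⟨d, -, hd⟩ := intermediate_value_Icc (neg_le_self (abs_nonneg E)) hcont.continuousOn
    (show E ∈ Icc _ _ from ⟨hlow.trans (neg_abs_le E), (le_abs_self E).trans hup⟩)
  exact ⟨d, hd⟩

theorem abs_shift_sub_le (h : FiberPair e ρ ρ' Q z r A B) {d : Plane → ℝ}
    (hd : ∀ x, ∫ s in (0 : ℝ)..d x, ρ' (x + s • e) = fiberExcess e ρ ρ' x) (x y : Plane) :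
    |d x - d y| ≤ (4 * r * B * A + 8 * r * A) * dist x y := by
  have hA := h.nonneg_lip
  have hc' := h.symm.continuous
  have hi : ∀ w : Plane, ∀ a b : ℝ, IntervalIntegrable (fun s : ℝ => ρ' (w + s • e)) volume a b :=
    fun w a b => Continuous.intervalIntegrable (by fun_prop) _ _
  have hdx : |d x| ≤ 4 * r * B := by
    have := h.abs_sub_le_abs_integral x (d x) 0
    rw [hd x, intervalIntegral.integral_same, sub_zero, sub_zero] at this
    exact this.trans (h.abs_fiberExcess_le x)
  -- With the same shift on both lines, the error is at most `|d x| ≤ 4 * r * B` times the variation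
  -- of `ρ'`. The variation of the excess gives the other term of the constant.
  have h1 : |(∫ s in (0 : ℝ)..d x, ρ' (y + s • e)) - ∫ s in (0 : ℝ)..d x, ρ' (x + s • e)|
      ≤ A * dist x y * |d x| := by
    rw [← intervalIntegral.integral_sub (hi _ _ _) (hi _ _ _)]
    have := intervalIntegral.norm_integral_le_of_norm_le_const (a := 0) (b := d x)
      (f := fun s : ℝ => ρ' (y + s • e) - ρ' (x + s • e)) (C := A * dist x y) fun s _ => by
        have := h.lip' (y + s • e) (x + s • e)
        rwa [dist_add_right, dist_comm] at this
    simpa using this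
  have h2 := h.abs_fiberExcess_sub_le x y
  calc |d x - d y| ≤ |(∫ s in (0 : ℝ)..d x, ρ' (y + s • e)) - ∫ s in (0 : ℝ)..d y, ρ' (y + s • e)| :=
        h.abs_sub_le_abs_integral y _ _
    _ = |((∫ s in (0 : ℝ)..d x, ρ' (y + s • e)) - ∫ s in (0 : ℝ)..d x, ρ' (x + s • e))
          + (fiberExcess e ρ ρ' x - fiberExcess e ρ ρ' y)| := by
        rw [hd y, ← hd x]; congr 1; ring
    _ ≤ A * dist x y * |d x| + 8 * r * A * dist x y := (abs_add_le _ _).trans (add_le_add h1 h2)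
    _ ≤ A * dist x y * (4 * r * B) + 8 * r * A * dist x y := by gcongr
    _ = _ := by ring

theorem integral_shift_line (h : FiberPair e ρ ρ' Q z r A B) {d : Plane → ℝ}
    (hd : ∀ x, ∫ s in (0 : ℝ)..d x, ρ' (x + s • e) = fiberExcess e ρ ρ' x) (x : Plane) (t : ℝ) :
    ∫ s in (0 : ℝ)..(t + d (x + t • e)), ρ' (x + s • e)
      = fiberExcess e ρ ρ' x + ∫ s in (0 : ℝ)..t, ρ (x + s • e) := by
  have hc' := h.symm.continuous
  have hi : ∀ a b : ℝ, IntervalIntegrable (fun s : ℝ => ρ' (x + s • e)) volume a b := fun a b =>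
    Continuous.intervalIntegrable (by fun_prop) _ _
  have h1 := hd (x + t • e)
  rw [h.fiberExcess_add_smul] at h1
  have h2 : ∫ s in (0 : ℝ)..d (x + t • e), ρ' (x + t • e + s • e)
      = ∫ s in t..(t + d (x + t • e)), ρ' (x + s • e) := by
    have := intervalIntegral.integral_comp_add_right (a := 0) (b := d (x + t • e))
      (fun s : ℝ => ρ' (x + s • e)) t
    rw [zero_add, add_comm _ t] at this
    rw [← this]
    congr 1; ext s
    rw [show x + t • e + s • e = x + (s + t) • e by module]
  rw [h2] at h1
  rw [← intervalIntegral.integral_add_adjacent_intervals (hi 0 t) (hi t _), h1]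
  ring

theorem shift_shift (h : FiberPair e ρ ρ' Q z r A B) {d d' : Plane → ℝ}
    (hd : ∀ x, ∫ s in (0 : ℝ)..d x, ρ' (x + s • e) = fiberExcess e ρ ρ' x)
    (hd' : ∀ x, ∫ s in (0 : ℝ)..d' x, ρ (x + s • e) = fiberExcess e ρ' ρ x) (x : Plane) :
    d' (x + d x • e) = -d x := by
  have h1 := h.symm.integral_shift_line hd' x (d x)
  rw [hd x, fiberExcess_symm, neg_add_cancel] at h1
  have h2 := h.symm.abs_sub_le_abs_integral x (d x + d' (x + d x • e)) 0
  rw [h1, intervalIntegral.integral_same, sub_zero, sub_self, abs_zero] at h2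
  have := abs_nonpos_iff.1 h2
  linarith

theorem transportable (h : FiberPair e ρ ρ' Q z r A B) :
    Transportable Q (1 + (4 * r * B * A + 8 * r * A)) ρ ρ' := by
  choose d hd using h.exists_shift
  choose d' hd' using h.symm.exists_shift
  have hlip : ∀ {ρ ρ' : Plane → ℝ} (h : FiberPair e ρ ρ' Q z r A B) {d : Plane → ℝ}
      (_ : ∀ x, ∫ s in (0 : ℝ)..d x, ρ' (x + s • e) = fiberExcess e ρ ρ' x) (x y : Plane),
      dist (x + d x • e) (y + d y • e) ≤ (1 + (4 * r * B * A + 8 * r * A)) * dist x y := by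
    intro ρ ρ' h d hd x y
    calc dist (x + d x • e) (y + d y • e) ≤ dist x y + dist (d x • e) (d y • e) :=
          dist_add_add_le _ _ _ _
      _ = dist x y + |d x - d y| := by
          rw [dist_eq_norm (d x • e), ← sub_smul, norm_smul, h.norm_eq, mul_one, Real.norm_eq_abs]
      _ ≤ dist x y + (4 * r * B * A + 8 * r * A) * dist x y := by
          gcongr; exact h.abs_shift_sub_le hd x y
      _ = _ := by ring
  refine ⟨⟨fun x => x + d x • e, fun x => x + d' x • e, fun x => ?_, fun x => ?_⟩,
    hlip h hd, hlip h.symm hd', fun x hx => ?_, ?_⟩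
  · simp [h.shift_shift hd hd' x]
  · simp [h.symm.shift_shift hd' hd x]
  · have h1 := h.abs_sub_le_abs_integral x (d x) 0
    rw [hd x, h.fiberExcess_eq_zero hx] at h1
    have h2 : d x = 0 := by simpa using h1
    simp [h2]
  have hdl : LipschitzWith (4 * r * B * A + 8 * r * A).toNNReal d :=
    LipschitzWith.of_dist_le' fun x y => by rw [Real.dist_eq]; exact h.abs_shift_sub_le hd x y
  filter_upwards [hdl.ae_differentiableAt] with x hx
  change DifferentiableAt ℝ (fun x => x + d x • e) x ∧
    (fderiv ℝ (fun x => x + d x • e) x).det * ρ' (x + d x • e) = ρ x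
  have hF : HasFDerivAt (fun x => x + d x • e)
      ((1 : ℝ) • ContinuousLinearMap.id ℝ Plane + (fderiv ℝ d x).smulRight e) x := by
    rw [one_smul]
    exact (hasFDerivAt_id x).add (hx.hasFDerivAt.smul_const e)
  refine ⟨hF.differentiableAt, ?_⟩
  rw [hF.fderiv, det_smul_id_add_smulRight]
  -- The determinant of this shear is `1 + fderiv ℝ d x e`, so the Jacobian equation is the
  -- derivative at `t = 0` of `integral_shift_line`.
  have hG : HasDerivAt (fun t : ℝ => t + d (x + t • e)) (1 + fderiv ℝ d x e) 0 := by
    have h1 : HasDerivAt (fun t : ℝ => x + t • e) e 0 := by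
      simpa using ((hasDerivAt_id (0 : ℝ)).smul_const e).const_add x
    have hx' : HasFDerivAt d (fderiv ℝ d x) (x + (0 : ℝ) • e) := by simpa using hx.hasFDerivAt
    exact (hasDerivAt_id (0 : ℝ)).add (hx'.comp_hasDerivAt (0 : ℝ) h1)
  have hprim : ∀ {σ : Plane → ℝ} (_ : Continuous σ) (t : ℝ),
      HasDerivAt (fun t : ℝ => ∫ s in (0 : ℝ)..t, σ (x + s • e)) (σ (x + t • e)) t := by
    intro σ hσ t
    have hc : Continuous fun s : ℝ => σ (x + s • e) := by fun_prop
    exact intervalIntegral.integral_hasDerivAt_right (hc.intervalIntegrable _ _)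
      (hc.stronglyMeasurableAtFilter _ _) hc.continuousAt
  have h1 : HasDerivAt (fun t : ℝ => ∫ s in (0 : ℝ)..(t + d (x + t • e)), ρ' (x + s • e))
      (ρ' (x + (0 + d (x + (0 : ℝ) • e)) • e) * (1 + fderiv ℝ d x e)) 0 :=
    (hprim h.symm.continuous _).comp (0 : ℝ) hG
  have h2 := (hprim h.continuous 0).const_add (fiberExcess e ρ ρ' x)
  rw [funext (h.integral_shift_line hd x)] at h1
  have h3 := h1.unique h2
  simp only [zero_smul, add_zero, zero_add] at h3
  rw [← h3]; ring

end FiberPair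

/-! ### Moving a bump -/

/-- A nonnegative, bounded, Lipschitz function supported in `S`. -/
structure IsBump (b : Plane → ℝ) (S : Set Plane) : Prop where
  nonneg : ∀ x, 0 ≤ b x
  lip : ∃ M : ℝ, 0 ≤ M ∧ ∀ x y, |b x - b y| ≤ M * dist x y
  bdd : ∃ B : ℝ, ∀ x, b x ≤ B
  eq_off : ∀ x ∉ S, b x = 0

namespace IsBump

variable {b c : Plane → ℝ} {S S' : Set Plane}

theorem continuous (hb : IsBump b S) : Continuous b :=
  continuous_of_abs_sub_le hb.lip.choose_spec.2

theorem mono (hb : IsBump b S) (h : S ⊆ S') : IsBump b S' :=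
  ⟨hb.nonneg, hb.lip, hb.bdd, fun x hx => hb.eq_off x fun hx' => hx (h hx')⟩

theorem const_mul (hb : IsBump b S) {k : ℝ} (hk : 0 ≤ k) : IsBump (fun x => k * b x) S := by
  obtain ⟨M, hM, hl⟩ := hb.lip
  obtain ⟨B, hB⟩ := hb.bdd
  refine ⟨fun x => mul_nonneg hk (hb.nonneg x), ⟨k * M, by positivity, fun x y => ?_⟩,
    ⟨k * B, fun x => by gcongr; exact hB x⟩, fun x hx => by rw [hb.eq_off x hx, mul_zero]⟩
  rw [← mul_sub, abs_mul, abs_of_nonneg hk, mul_assoc]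
  gcongr
  exact hl x y

end IsBump

/-- Two bumps with equal integrals along all lines of a given direction can be exchanged, over any
small Lipschitz background. -/
theorem exists_transportable_of_line_integral_eq {b c : Plane → ℝ} {Q : Set Plane} {e z : Plane}
    {r : ℝ} (he : ‖e‖ = 1) (hQ : Convex ℝ Q) (hr : 0 ≤ r) (hQr : Q ⊆ Metric.closedBall z r)
    (hb : IsBump b Q) (hc : IsBump c Q)
    (hbc : ∀ x, ∫ s : ℝ, b (x + s • e) = ∫ s : ℝ, c (x + s • e)) {A : ℝ} (hA : 0 ≤ A) :
    ∃ k : ℝ, ∀ ε a : ℝ, 0 ≤ a → a ≤ ε → ∀ h : Plane → ℝ, (∀ x, 0 ≤ h x) →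
      (∀ x y, |h x - h y| ≤ A * ε * dist x y) →
      Transportable Q ((1 + ε) ^ k) (fun x => 1 + h x + a * b x) (fun x => 1 + h x + a * c x) := by
  obtain ⟨Mb, hMb, hlb⟩ := hb.lip
  obtain ⟨Mc, hMc, hlc⟩ := hc.lip
  obtain ⟨Bb, hBb⟩ := hb.bdd
  obtain ⟨Bc, hBc⟩ := hc.bdd
  have hBb0 : 0 ≤ Bb := (hb.nonneg 0).trans (hBb 0)
  have hBc0 : 0 ≤ Bc := (hc.nonneg 0).trans (hBc 0)
  set N := r * (A + (Mb + Mc)) with hN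
  have hN0 : 0 ≤ N := by positivity
  set C := 1 + 4 * N * (Bb + Bc + 1) with hC
  -- The shear costs `1 + O(ε) + O(ε ^ 2)`; `C` is chosen so that this is at most `(1 + C * ε) ^ 2`,
  -- hence the exponent twice that of Bernoulli.
  refine ⟨max C 1 * 2, fun ε a ha haε h hh hhl => ?_⟩
  have hε := ha.trans haε
  have hlip : ∀ {b : Plane → ℝ} {M : ℝ}, M ≤ Mb + Mc → (∀ x y, |b x - b y| ≤ M * dist x y) →
      ∀ x y, |(1 + h x + a * b x) - (1 + h y + a * b y)| ≤ (A + (Mb + Mc)) * ε * dist x y := by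
    intro b M hM hl x y
    have h1 : a * |b x - b y| ≤ ε * ((Mb + Mc) * dist x y) := by
      gcongr
      exact (hl x y).trans (by gcongr)
    calc _ = |(h x - h y) + a * (b x - b y)| := by congr 1; ring
      _ ≤ |h x - h y| + a * |b x - b y| := by
          rw [← abs_of_nonneg ha, ← abs_mul, abs_of_nonneg ha]; exact abs_add_le _ _
      _ ≤ A * ε * dist x y + ε * ((Mb + Mc) * dist x y) := add_le_add (hhl x y) h1
      _ = _ := by ring
  have hpair : FiberPair e (fun x => 1 + h x + a * b x) (fun x => 1 + h x + a * c x) Q z r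
      ((A + (Mb + Mc)) * ε) (ε * (Bb + Bc)) := by
    refine ⟨he, fun x => ?_, fun x => ?_, hlip (by linarith) hlb, hlip (by linarith) hlc, hQ, hQr,
      hr, fun x hx => by rw [hb.eq_off x hx, hc.eq_off x hx], fun x => ?_, fun x => ?_⟩
    · have := mul_nonneg ha (hb.nonneg x)
      linarith [hh x]
    · have := mul_nonneg ha (hc.nonneg x)
      linarith [hh x]
    · have h1 : |b x - c x| ≤ Bb + Bc := by
        rw [abs_le]
        constructor <;> linarith [hb.nonneg x, hc.nonneg x, hBb x, hBc x]
      calc _ = a * |b x - c x| := by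
            rw [← abs_of_nonneg ha, ← abs_mul, abs_of_nonneg ha]; congr 1; ring
        _ ≤ _ := by gcongr
    · have e1 : ∀ s : ℝ, (1 + h (x + s • e) + a * b (x + s • e))
          - (1 + h (x + s • e) + a * c (x + s • e))
          = a * (b (x + s • e) - c (x + s • e)) := fun s => by ring
      have hi : ∀ {b : Plane → ℝ}, IsBump b Q → Integrable fun s : ℝ => b (x + s • e) :=
        fun hb => integrable_line hb.continuous he
          (fun y hy => hb.eq_off y fun hy' => hy (hQr hy')) x
      simp only [e1]
      rw [integral_const_mul, integral_sub (hi hb) (hi hc), hbc x, sub_self, mul_zero]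
  refine hpair.transportable.mono ?_ subset_rfl
  have h1 := one_add_mul_le_rpow (C := C) hε
  have hC1 : 1 ≤ C := by
    have : 0 ≤ 4 * N * (Bb + Bc + 1) := by positivity
    linarith
  rw [Real.rpow_mul (by positivity), Real.rpow_two]
  refine le_trans ?_ (pow_le_pow_left₀ (by positivity) h1 2)
  have h2 : 4 * N * (Bb + Bc) ≤ C ^ 2 := by nlinarith
  have h3 : 8 * N ≤ 2 * C := by
    have : 0 ≤ N * (Bb + Bc) := by positivity
    linarith
  calc 1 + (4 * r * (ε * (Bb + Bc)) * ((A + (Mb + Mc)) * ε) + 8 * r * ((A + (Mb + Mc)) * ε))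
      = 1 + (4 * N * (Bb + Bc) * ε ^ 2 + 8 * N * ε) := by rw [hN]; ring
    _ ≤ 1 + (C ^ 2 * ε ^ 2 + 2 * C * ε) := by gcongr
    _ = _ := by ring

/-- The rotation by a right angle. -/
def planeRot (e : Plane) : Plane := !₂[-e 1, e 0]

theorem norm_planeRot (e : Plane) : ‖planeRot e‖ = ‖e‖ := by
  simp [EuclideanSpace.norm_eq, planeRot, Fin.sum_univ_two, add_comm]

theorem inner_planeRot_self (e : Plane) : inner ℝ e (planeRot e) = 0 := by
  simp [planeRot, PiLp.inner_apply, Fin.sum_univ_two]; ring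

theorem inner_smul_add_inner_smul_planeRot {e : Plane} (he : ‖e‖ = 1) (x : Plane) :
    inner ℝ x e • e + inner ℝ x (planeRot e) • planeRot e = x := by
  have h : e 0 ^ 2 + e 1 ^ 2 = 1 := by
    have := EuclideanSpace.norm_sq_eq e
    simpa [he, Fin.sum_univ_two] using this.symm
  ext i
  fin_cases i
  · simp [planeRot, PiLp.inner_apply, Fin.sum_univ_two]; linear_combination x 0 * h
  · simp [planeRot, PiLp.inner_apply, Fin.sum_univ_two]; linear_combination x 1 * h

/-- A Lipschitz bump on the line, supported in `[-η, η]`, of integral one. -/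
theorem exists_line_bump {η : ℝ} (hη : 0 < η) : ∃ χ : ℝ → ℝ, (∀ t, 0 ≤ χ t) ∧
    (∃ M, 0 ≤ M ∧ ∀ s t, |χ s - χ t| ≤ M * |s - t|) ∧ (∃ B, ∀ t, χ t ≤ B) ∧
    (∀ t, η < |t| → χ t = 0) ∧ ∫ t, χ t = 1 := by
  have hnn : ∀ t : ℝ, 0 ≤ max (η - |t|) 0 := fun t => le_max_right _ _
  have hX : 0 < ∫ t : ℝ, max (η - |t|) 0 := by
    refine Continuous.integral_pos_of_hasCompactSupport_nonneg_nonzero (by fun_prop) ?_ hnn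
      (x := 0) (by simp [hη.ne', hη.le])
    refine HasCompactSupport.intro (isCompact_Icc (a := -η) (b := η)) fun t ht => ?_
    refine max_eq_right ?_
    by_contra! h
    exact ht (abs_le.1 (by linarith))
  set X := ∫ t : ℝ, max (η - |t|) 0 with hXdef
  refine ⟨fun t => X⁻¹ * max (η - |t|) 0, fun t => mul_nonneg (by positivity) (hnn t),
    ⟨X⁻¹, by positivity, fun s t => ?_⟩, ⟨X⁻¹ * η, fun t => ?_⟩, fun t ht => ?_, ?_⟩
  · rw [← mul_sub, abs_mul, abs_of_pos (by positivity : 0 < X⁻¹)]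
    refine mul_le_mul_of_nonneg_left ?_ (by positivity)
    have h1 : |max (η - |s|) 0 - max (η - |t|) 0| ≤ |(η - |s|) - (η - |t|)| := by
      simpa using abs_max_sub_max_le_max (η - |s|) 0 (η - |t|) 0
    refine h1.trans ?_
    rw [sub_sub_sub_cancel_left, abs_sub_comm]
    exact abs_abs_sub_abs_le _ _
  · refine mul_le_mul_of_nonneg_left ?_ (by positivity)
    exact max_le (by linarith [abs_nonneg t]) hη.le
  · simp only
    rw [max_eq_right (by linarith), mul_zero]
  · rw [integral_const_mul, ← hXdef, inv_mul_cancel₀ hX.ne']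

/-- The integral of `b` along the line through `x` of direction `e`. -/
noncomputable def lineIntegral (b : Plane → ℝ) (e x : Plane) : ℝ := ∫ s : ℝ, b (x + s • e)

theorem lineIntegral_add_smul (b : Plane → ℝ) (e x : Plane) (t : ℝ) :
    lineIntegral b e (x + t • e) = lineIntegral b e x := by
  rw [lineIntegral, lineIntegral, ← integral_add_right_eq_self (fun s : ℝ => b (x + s • e)) t]
  congr 1; ext s
  rw [show x + t • e + s • e = x + (s + t) • e by module]

/-! ### Product-shaped bumps with prescribed line integrals -/

section Spread

variable {b : Plane → ℝ} {e p z : Plane} {η : ℝ} {χ : ℝ → ℝ}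

/-- The spread of `b`: its integral along lines orthogonal to `e`, times `χ` of the coordinate
orthogonal to `e`. -/
noncomputable def spread (b : Plane → ℝ) (e p : Plane) (χ : ℝ → ℝ) (x : Plane) : ℝ :=
  lineIntegral b (planeRot e) x * χ (inner ℝ (x - p) (planeRot e))

theorem isBump_lineIntegral (hb : IsBump b (Metric.closedBall z η)) (hη : 0 ≤ η) (he : ‖e‖ = 1) :
    IsBump (lineIntegral b (planeRot e)) {x | |inner ℝ (x - z) e| ≤ η} := by
  obtain ⟨M, hM, hl⟩ := hb.lip
  obtain ⟨B, hB⟩ := hb.bdd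
  have he' : ‖planeRot e‖ = 1 := by rw [norm_planeRot, he]
  refine ⟨fun x => integral_nonneg fun s => hb.nonneg _, ⟨4 * η * M, by positivity, fun x y => ?_⟩,
    ⟨4 * η * B, fun x => ?_⟩, fun x hx => ?_⟩
  · simpa [lineIntegral] using abs_lineIntegral_sub_le hl he' hη hb.eq_off univ x y
  · have := abs_lineIntegral_le hb.continuous he' hη hb.eq_off
      (fun y => by rw [abs_of_nonneg (hb.nonneg y)]; exact hB y) univ x
    rw [setIntegral_univ] at this
    exact (le_abs_self _).trans this
  · rw [lineIntegral]
    refine integral_eq_zero_of_ae (Filter.Eventually.of_forall fun s => hb.eq_off _ fun hm => hx ?_)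
    rw [Metric.mem_closedBall, dist_eq_norm] at hm
    have h1 := (abs_real_inner_le_norm (x + s • planeRot e - z) e).trans (by rw [he, mul_one])
    have h2 : inner ℝ (x + s • planeRot e - z) e = inner ℝ (x - z) e := by
      rw [show x + s • planeRot e - z = (x - z) + s • planeRot e by abel, inner_add_left,
        real_inner_smul_left, real_inner_comm e (planeRot e), inner_planeRot_self, mul_zero, add_zero]
    rw [h2] at h1
    exact h1.trans hm

theorem isBump_spread (hb : IsBump b (Metric.closedBall z η)) (hη : 0 ≤ η) (he : ‖e‖ = 1)
    (hz : inner ℝ (z - p) (planeRot e) = 0) (hχ0 : ∀ t, 0 ≤ χ t)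
    (hχl : ∃ M, 0 ≤ M ∧ ∀ s t, |χ s - χ t| ≤ M * |s - t|) (hχb : ∃ B, ∀ t, χ t ≤ B)
    (hχs : ∀ t, η < |t| → χ t = 0) :
    IsBump (spread b e p χ) (Metric.closedBall z (2 * η)) := by
  have hI := isBump_lineIntegral hb hη he
  have he' : ‖planeRot e‖ = 1 := by rw [norm_planeRot, he]
  obtain ⟨M, hM, hl⟩ := hI.lip
  obtain ⟨B, hB⟩ := hI.bdd
  obtain ⟨M', hM', hl'⟩ := hχl
  obtain ⟨B', hB'⟩ := hχb
  have hB0 : 0 ≤ B := (hI.nonneg 0).trans (hB 0)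
  have hB0' : 0 ≤ B' := (hχ0 0).trans (hB' 0)
  refine ⟨fun x => mul_nonneg (hI.nonneg x) (hχ0 _), ⟨M * B' + B * M', by positivity,
    fun x y => ?_⟩, ⟨B * B', fun x => mul_le_mul (hB x) (hB' _) (hχ0 _) hB0⟩, fun x hx => ?_⟩
  · have hin : |inner ℝ (x - p) (planeRot e) - inner ℝ (y - p) (planeRot e)| ≤ dist x y := by
      rw [← inner_sub_left, sub_sub_sub_cancel_right, dist_eq_norm]
      exact (abs_real_inner_le_norm _ _).trans (by rw [he', mul_one])
    have e1 : spread b e p χ x - spread b e p χ y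
        = (lineIntegral b (planeRot e) x - lineIntegral b (planeRot e) y)
            * χ (inner ℝ (x - p) (planeRot e))
          + lineIntegral b (planeRot e) y
            * (χ (inner ℝ (x - p) (planeRot e)) - χ (inner ℝ (y - p) (planeRot e))) := by
      rw [spread, spread]; ring
    rw [e1]
    refine (abs_add_le _ _).trans ?_
    rw [abs_mul, abs_mul, abs_of_nonneg (hχ0 _), abs_of_nonneg (hI.nonneg y)]
    calc _ ≤ (M * dist x y) * B' + B * (M' * dist x y) := by
          gcongr
          · exact hχ0 _
          · exact hl x y
          · exact hB' _
          · exact hB y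
          · exact (hl' _ _).trans (by gcongr)
      _ = _ := by ring
  · by_cases h1 : |inner ℝ (x - z) e| ≤ η
    · by_cases h2 : |inner ℝ (x - p) (planeRot e)| ≤ η
      · refine absurd ?_ hx
        have h3 : inner ℝ (x - p) (planeRot e) = inner ℝ (x - z) (planeRot e) := by
          rw [← sub_add_sub_cancel x z p, inner_add_left, hz, add_zero]
        rw [h3] at h2
        rw [Metric.mem_closedBall, dist_eq_norm, ← inner_smul_add_inner_smul_planeRot he (x - z)]
        refine (norm_add_le _ _).trans ?_
        rw [norm_smul, norm_smul, he, he', Real.norm_eq_abs, Real.norm_eq_abs]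
        linarith
      · rw [spread, hχs _ (not_le.1 h2), mul_zero]
    · rw [spread, hI.eq_off x h1, zero_mul]

theorem integral_spread_orthogonal (he : ‖e‖ = 1) (hχ1 : ∫ t, χ t = 1) (x : Plane) :
    ∫ s : ℝ, spread b e p χ (x + s • planeRot e) = lineIntegral b (planeRot e) x := by
  have he' : ‖planeRot e‖ = 1 := by rw [norm_planeRot, he]
  have e1 : ∀ s : ℝ, spread b e p χ (x + s • planeRot e)
      = lineIntegral b (planeRot e) x * χ (s + inner ℝ (x - p) (planeRot e)) := fun s => by
    rw [spread, lineIntegral_add_smul, show x + s • planeRot e - p = s • planeRot e + (x - p) by abel,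
      inner_add_left, real_inner_smul_left, real_inner_self_eq_norm_sq, he']
    simp
  simp only [e1]
  rw [integral_const_mul, integral_add_right_eq_self χ, hχ1, mul_one]

/-- Along lines of direction `e`, the spreads of any two bumps have integrals proportional to the
same profile `χ`. After rescaling they can be exchanged by one shear along `e`. -/
theorem integral_spread_parallel (he : ‖e‖ = 1) (x : Plane) :
    ∫ s : ℝ, spread b e p χ (x + s • e)
      = (∫ s : ℝ, lineIntegral b (planeRot e) (p + s • e))
        * χ (inner ℝ (x - p) (planeRot e)) := by
  have hx := inner_smul_add_inner_smul_planeRot he (x - p)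
  set u := inner ℝ (x - p) e
  set v := inner ℝ (x - p) (planeRot e) with hv
  have e1 : ∀ s : ℝ, spread b e p χ (x + s • e)
      = lineIntegral b (planeRot e) (p + (s + u) • e) * χ v := fun s => by
    rw [spread, show x + s • e - p = (x - p) + s • e by abel, inner_add_left, real_inner_smul_left,
      inner_planeRot_self, mul_zero, add_zero, ← hv]
    congr 1
    rw [← lineIntegral_add_smul b (planeRot e) (p + (s + u) • e) v]
    congr 1
    rw [← sub_eq_zero]
    calc x + s • e - (p + (s + u) • e + v • planeRot e)
        = (x - p) - (u • e + v • planeRot e) := by module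
      _ = 0 := by rw [hx, sub_self]
  simp only [e1]
  rw [integral_mul_const,
    integral_add_right_eq_self (fun s : ℝ => lineIntegral b (planeRot e) (p + s • e))]

end Spread

theorem exists_unit_eq_add_smul (p q : Plane) : ∃ (e : Plane) (t : ℝ), ‖e‖ = 1 ∧ q = p + t • e := by
  by_cases h : q = p
  · exact ⟨EuclideanSpace.single 0 1, 0, by simp, by simp [h]⟩
  · refine ⟨‖q - p‖⁻¹ • (q - p), ‖q - p‖, ?_, ?_⟩
    · exact norm_smul_inv_norm (𝕜 := ℝ) (sub_ne_zero.2 h)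
    · rw [smul_inv_smul₀ (norm_ne_zero_iff.2 (sub_ne_zero.2 h)), add_sub_cancel]

/-- A bump near `q` can be moved to a multiple of a given bump near `p` along the segment, over any
small Lipschitz background. -/
theorem exists_transportable_move {p q : Plane} {b₀ b₁ : Plane → ℝ} {η : ℝ} (hη : 0 < η)
    (hb₀ : IsBump b₀ (Metric.closedBall q η)) (hb₁ : IsBump b₁ (Metric.closedBall p η))
    (hpos : 0 < b₁ p) : ∃ κ : ℝ, 0 ≤ κ ∧ ∀ A : ℝ, 0 ≤ A → ∃ k : ℝ, ∀ ε a : ℝ, 0 ≤ a → a ≤ ε →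
      ∀ h : Plane → ℝ, (∀ x, 0 ≤ h x) → (∀ x y, |h x - h y| ≤ A * ε * dist x y) →
      Transportable (Metric.cthickening (2 * η) (segment ℝ p q)) ((1 + ε) ^ k)
        (fun x => 1 + h x + a * b₀ x) (fun x => 1 + h x + a * (κ * b₁ x)) := by
  obtain ⟨e, t, he, rfl⟩ := exists_unit_eq_add_smul p q
  have he' : ‖planeRot e‖ = 1 := by rw [norm_planeRot, he]
  obtain ⟨χ, hχ0, hχl, hχb, hχs, hχ1⟩ := exists_line_bump hη
  set I₀ := ∫ s : ℝ, lineIntegral b₀ (planeRot e) (p + s • e)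
  set I₁ := ∫ s : ℝ, lineIntegral b₁ (planeRot e) (p + s • e) with hI₁
  have hB₁ := isBump_lineIntegral hb₁ hη.le he
  have hI₀0 : 0 ≤ I₀ := integral_nonneg fun s =>
    (isBump_lineIntegral hb₀ hη.le he).nonneg _
  have hI₁0 : 0 < I₁ := by
    refine Continuous.integral_pos_of_hasCompactSupport_nonneg_nonzero
      (hB₁.continuous.comp (by fun_prop)) ?_ (fun s => hB₁.nonneg _) (x := 0) ?_
    · refine HasCompactSupport.intro (isCompact_Icc (a := -η) (b := η)) fun s hs =>
        hB₁.eq_off _ fun hm => hs ?_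
      have h1 : inner ℝ (p + s • e - p) e = s := by
        rw [add_sub_cancel_left, real_inner_smul_left, real_inner_self_eq_norm_sq, he]; ring
      change |inner ℝ (p + s • e - p) e| ≤ η at hm
      rw [h1] at hm
      exact abs_le.1 hm
    · refine ne_of_gt ?_
      rw [zero_smul, add_zero]
      refine Continuous.integral_pos_of_hasCompactSupport_nonneg_nonzero
        (hb₁.continuous.comp (by fun_prop)) ?_ (fun s => hb₁.nonneg _) (x := 0)
        (by rw [zero_smul, add_zero]; exact hpos.ne')
      refine HasCompactSupport.intro (isCompact_Icc (a := -η) (b := η)) fun s hs =>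
        hb₁.eq_off _ fun hm => hs ?_
      have := mem_Icc_inner_of_mem_closedBall he' hm
      simpa using this
  -- The ratio of total masses. It depends neither on `ε` nor on the background, so it is available
  -- before the Lipschitz bound `A` is fixed.
  set κ := I₀ / I₁ with hκ
  have hκ0 : 0 ≤ κ := by positivity
  refine ⟨κ, hκ0, fun A hA => ?_⟩
  set q := p + t • e
  set Q := Metric.cthickening (2 * η) (segment ℝ p q)
  have hQ : Convex ℝ Q := (convex_segment p q).cthickening _
  have hQb : Bornology.IsBounded Q := by
    refine Bornology.IsBounded.cthickening ?_
    rw [← convexHull_pair]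
    exact isBounded_convexHull.2 (Set.toFinite _).isBounded
  obtain ⟨r', hr'⟩ := hQb.subset_closedBall p
  have hQr : Q ⊆ Metric.closedBall p (max r' 0) :=
    hr'.trans (Metric.closedBall_subset_closedBall (le_max_left _ _))
  have hr : 0 ≤ max r' 0 := le_max_right _ _
  have hball : ∀ z ∈ segment ℝ p q, Metric.closedBall z (2 * η) ⊆ Q := fun z hz =>
    Metric.closedBall_subset_cthickening hz _
  have hsmall : ∀ z : Plane, Metric.closedBall z η ⊆ Metric.closedBall z (2 * η) := fun z =>
    Metric.closedBall_subset_closedBall (by linarith)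
  have hqQ := hball q (right_mem_segment ℝ p q)
  have hpQ := hball p (left_mem_segment ℝ p q)
  have hc₀ := (isBump_spread (χ := χ) (p := p) hb₀ hη.le he (by
    rw [add_sub_cancel_left, real_inner_smul_left, inner_planeRot_self, mul_zero]) hχ0 hχl hχb
    hχs).mono hqQ
  have hc₁ := (isBump_spread (χ := χ) (p := p) hb₁ hη.le he (by simp) hχ0 hχl hχb hχs).mono hpQ
  have hb₀Q := hb₀.mono ((hsmall q).trans hqQ)
  have hb₁Q := hb₁.mono ((hsmall p).trans hpQ)
  -- Three shears: orthogonal to `e` from `b₀` to its spread, along `e` to `κ` times the spread of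
  -- `b₁`, and orthogonal again to `κ * b₁`.
  obtain ⟨k₁, h₁⟩ := exists_transportable_of_line_integral_eq he' hQ hr hQr hb₀Q hc₀
    (fun x => (integral_spread_orthogonal he hχ1 x).symm) hA
  obtain ⟨k₂, h₂⟩ := exists_transportable_of_line_integral_eq he hQ hr hQr hc₀
    (hc₁.const_mul hκ0) (fun x => by
      rw [integral_const_mul, integral_spread_parallel he, integral_spread_parallel he, ← mul_assoc,
        ← hI₁, hκ, div_mul_cancel₀ _ hI₁0.ne']) hA
  obtain ⟨k₃, h₃⟩ := exists_transportable_of_line_integral_eq he' hQ hr hQr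
    (hc₁.const_mul hκ0) (hb₁Q.const_mul hκ0) (fun x => by
      rw [integral_const_mul, integral_const_mul, integral_spread_orthogonal he hχ1]; rfl) hA
  refine ⟨k₁ + k₂ + k₃, fun ε a ha haε h hh hl => ?_⟩
  have hε : 0 < 1 + ε := by linarith
  exact ((h₁ ε a ha haε h hh hl).trans_rpow hε (h₂ ε a ha haε h hh hl)).trans_rpow hε
    (h₃ ε a ha haε h hh hl)

/-! ### Assembling the transports -/

/-- The finite set records which pieces have already been treated; each new piece adds its exponent.
-/
theorem Transportable.of_insert {ι : Type*} [DecidableEq ι] {U : Set Plane} {t : ℝ} (ht : 0 < t)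
    (k : ι → ℝ) (ρ : Finset ι → Plane → ℝ)
    (h : ∀ S i, i ∉ S → Transportable U (t ^ k i) (ρ S) (ρ (insert i S))) (S : Finset ι) :
    Transportable U (t ^ ∑ i ∈ S, k i) (ρ ∅) (ρ S) := by
  induction S using Finset.induction_on with
  | empty => simpa using Transportable.refl U (ρ ∅)
  | insert i S hi ih =>
    rw [Finset.sum_insert hi, add_comm]
    exact ih.trans_rpow ht (h S i hi)

/-- The bump of width `l` in terms of a gauge. -/
noncomputable def gaugeBump (g : Plane → ℝ) (l : ℝ) (x : Plane) : ℝ := bumpProfile (g x / l) / l ^ 2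

theorem gaugeBump_eq_zero {g : Plane → ℝ} {l : ℝ} (hl : 0 < l) {x : Plane} (hx : l ≤ g x) :
    gaugeBump g l x = 0 := by
  rw [gaugeBump, bumpProfile_eq_zero ((one_le_div hl).2 hx), zero_div]

theorem IsRadialGauge.isBump_gaugeBump {g : Plane → ℝ} {p : Plane} {K R : ℝ}
    (hg : IsRadialGauge g p K R) {l : ℝ} (hl : 0 < l) :
    IsBump (gaugeBump g l) (Metric.closedBall p (R * l)) := by
  have hK := hg.nonneg_left
  have hR := hg.nonneg_right
  have hq : ∀ x, 0 ≤ g x / l := fun x => div_nonneg (hg.nonneg x) hl.le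
  refine ⟨fun x => div_nonneg (bumpProfile_nonneg (hq x)) (by positivity),
    ⟨4 * K / l ^ 3, by positivity, fun x y => ?_⟩, ⟨2 / l ^ 2, fun x => ?_⟩, fun x hx => ?_⟩
  · have h1 := abs_bumpProfile_sub_le (hq x) (hq y)
    rw [← sub_div, abs_div, abs_of_pos hl] at h1
    rw [gaugeBump, gaugeBump, ← sub_div, abs_div, abs_of_pos (by positivity : 0 < l ^ 2)]
    calc _ ≤ 4 * (K * dist x y / l) / l ^ 2 := by
          gcongr
          refine h1.trans ?_
          gcongr
          exact hg.lip x y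
      _ = _ := by field_simp
  · rw [gaugeBump]
    gcongr
    rw [bumpProfile]
    nlinarith [sq_nonneg (min (g x / l) 1)]
  · refine gaugeBump_eq_zero hl ?_
    by_contra! h
    exact hx ((hg.dist_le x).trans (mul_le_mul_of_nonneg_left h.le hR))

theorem IsRadialGauge.exists_isBump_gaugeBump {g : Plane → ℝ} {p : Plane} {K R : ℝ}
    (hg : IsRadialGauge g p K R) {η : ℝ} (hη : 0 < η) :
    ∃ l, 0 < l ∧ l < 1 ∧ IsBump (gaugeBump g l) (Metric.closedBall p η) := by
  have hR := hg.nonneg_right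
  have hl : 0 < min (1 / 2) (η / (R + 1)) := by positivity
  refine ⟨min (1 / 2) (η / (R + 1)), hl, (min_le_left _ _).trans_lt (by norm_num),
    (hg.isBump_gaugeBump hl).mono (Metric.closedBall_subset_closedBall ?_)⟩
  calc R * min (1 / 2) (η / (R + 1)) ≤ (R + 1) * (η / (R + 1)) := by
        gcongr
        · linarith
        · exact min_le_right _ _
    _ = η := by field_simp

theorem gaugeBump_center_pos {g : Plane → ℝ} {p : Plane} {K R l : ℝ}
    (hg : IsRadialGauge g p K R) (hl : 0 < l) : 0 < gaugeBump g l p := by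
  rw [gaugeBump, hg.center, zero_div, bumpProfile]
  simp [hl]

/-! ### From a transport to a self-map of the domain with the normalized Jacobian -/

namespace IsTransport

variable {φ : Plane ≃ Plane} {T : Set Plane} {L F : ℝ} {ρ ρ' : Plane → ℝ}

theorem map_mem (h : IsTransport φ (interior T) L ρ ρ') {S : Set Plane} (hS : interior T ⊆ S)
    {x : Plane} (hx : x ∈ S) : φ x ∈ S := by
  by_contra hn
  -- If `φ x` left `S`, it would be a fixed point, and injectivity would give `φ x = x`.
  have h1 := h.eq_off (φ x) fun h' => hn (hS h')
  exact hn (by rw [φ.injective h1]; exact hx)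

theorem bijOn (h : IsTransport φ (interior T) L ρ ρ') : BijOn φ T T := by
  refine ⟨fun x hx => h.map_mem interior_subset hx, φ.injective.injOn, fun y hy => ?_⟩
  refine ⟨φ.symm y, ?_, φ.apply_symm_apply y⟩
  by_contra hn
  have h1 := h.eq_off (φ.symm y) fun h' => hn (interior_subset h')
  rw [φ.apply_symm_apply] at h1
  exact hn (h1 ▸ hy)

theorem isBiLipSelfMap (h : IsTransport φ (interior T) L ρ ρ') : IsBiLipSelfMap L φ T :=
  ⟨h.bijOn, fun x _ y _ => h.lip x y, fun x _ y _ => by simpa using h.lip_symm (φ x) (φ y)⟩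

theorem setIntegral_abs_det (h : IsTransport φ (interior T) L ρ ρ') (hT : MeasurableSet T) :
    ∫ x in T, |(fderiv ℝ φ x).det| = volume.real T := by
  set D := {x | DifferentiableAt ℝ φ x} with hD
  have hDm : MeasurableSet D := measurableSet_of_differentiableAt ℝ φ
  have hDn : volume Dᶜ = 0 := by
    have : ∀ᵐ x, x ∈ D := h.jac.mono fun x hx => hx.1
    exact this
  have h1 := integral_image_eq_integral_abs_det_fderiv_smul (volume : Measure Plane)
    (hT.inter hDm) (fun x hx => hx.2.hasFDerivAt.hasFDerivWithinAt) φ.injective.injOn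
    (fun _ => (1 : ℝ))
  have hTD : (T ∩ D : Set Plane) =ᵐ[volume] T := by
    refine (ae_eq_set).2 ⟨?_, measure_mono_null (fun x hx => ?_) hDn⟩
    · rw [sdiff_eq_empty.2 inter_subset_left, measure_empty]
    · exact fun hxD => hx.2 ⟨hx.1, hxD⟩
  have hφ : (φ '' (T ∩ D) : Set Plane) =ᵐ[volume] T := by
    refine (ae_eq_set).2 ⟨?_, ?_⟩
    · rw [sdiff_eq_empty.2, measure_empty]
      exact (image_mono inter_subset_left).trans h.bijOn.image_eq.subset
    · refine measure_mono_null (fun y hy => ?_) (volume_preimage_null_of_symm_lipschitz φ.symm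
        (by simpa using h.lip) hDn)
      obtain ⟨x, hx, rfl⟩ := h.bijOn.surjOn hy.1
      intro hxD
      rw [φ.symm_apply_apply] at hxD
      exact hy.2 ⟨x, ⟨hx, hxD⟩, rfl⟩
  rw [setIntegral_congr_set hφ, setIntegral_congr_set hTD] at h1
  simp only [smul_eq_mul, mul_one] at h1
  rw [← h1]
  simp

theorem ae_det_eq (h : IsTransport φ (interior T) L ρ ρ') (hT : MeasurableSet T)
    (hv : volume.real T ≠ 0) (hfr : volume (frontier T) = 0) (hF : 0 < F)
    (hρ' : ∀ x ∈ interior T, ρ' x = F) {f : Plane → ℝ}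
    {m : ℝ} (hm : 0 < m) (hf : ∀ x ∈ T, 0 < f x)
    (hfρ : ∀ᵐ x, x ∈ T → f x = m * ρ x) :
    ∀ᵐ x ∂(volume.restrict T), DifferentiableAt ℝ φ x ∧
      (fderiv ℝ φ x).det = volume.real T / (∫ y in T, f y) * f x := by
  have hae : ∀ᵐ x ∂(volume.restrict T), DifferentiableAt ℝ φ x ∧
      0 ≤ (fderiv ℝ φ x).det ∧ f x = m * F * (fderiv ℝ φ x).det := by
    rw [ae_restrict_iff' hT]
    have hfr' : ∀ᵐ x, x ∉ frontier T := by rw [ae_iff]; simpa using hfr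
    filter_upwards [h.jac, hfr', hfρ] with x hx hxfr hfx hxT
    have hxi : x ∈ interior T := by
      by_contra hn
      exact hxfr ⟨subset_closure hxT, hn⟩
    have h1 := hx.2
    rw [hρ' _ (h.map_mem subset_rfl hxi)] at h1
    have h2 : f x = m * F * (fderiv ℝ φ x).det := by rw [hfx hxT, ← h1]; ring
    refine ⟨hx.1, ?_, h2⟩
    have h3 := hf x hxT
    rw [h2] at h3
    exact (pos_of_mul_pos_right h3 (by positivity)).le
  -- Since `φ` maps `T` onto itself, its Jacobian integrates to the area of `T`. This identifies `F`
  -- without computing the masses of the bumps.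
  have hint : ∫ y in T, f y = m * F * volume.real T := by
    rw [← h.setIntegral_abs_det hT, ← integral_const_mul]
    refine integral_congr_ae (hae.mono fun x hx => ?_)
    simp only
    rw [abs_of_nonneg hx.2.1]
    exact hx.2.2
  filter_upwards [hae] with x hx
  refine ⟨hx.1, ?_⟩
  rw [hint]
  rw [hx.2.2]
  field_simp

end IsTransport

theorem IsStarDomain.volume_frontier {T : Set Plane} {p : Plane} (hT : IsStarDomain T p) :
    volume (frontier T) = 0 := by
  obtain ⟨K, R, hg⟩ := hT.isRadialGauge
  refine measure_mono_null (fun x hx => ?_) (hg.volume_level_eq_zero one_pos)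
  refine le_antisymm ((hT.mem_iff_starGauge_le x).1 (hT.isCompact.isClosed.frontier_subset hx)) ?_
  exact not_lt.1 fun h => hx.2 ((hT.mem_interior_iff_starGauge_lt x).2 h)

/-- The core construction, in terms of gauges: piecewise constant densities on disjoint star-shaped
pieces of `{g < 1}` are carried to a constant density. -/
theorem exists_transportable_const {n : ℕ} {g : Plane → ℝ} {p : Plane} {K R : ℝ}
    (hg : IsRadialGauge g p K R) {gs : Fin n → Plane → ℝ} {ps : Fin n → Plane} {Ks Rs : Fin n → ℝ}
    (hgs : ∀ i, IsRadialGauge (gs i) (ps i) (Ks i) (Rs i))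
    (hsub : ∀ i x, gs i x < 1 → g x < 1) (hdisj : ∀ i j, i ≠ j → ∀ x, gs i x < 1 → 1 ≤ gs j x) :
    ∃ c : ℝ, ∀ (ε : ℝ) (a : Fin n → ℝ), 0 ≤ ε → (∀ i, 0 ≤ a i) → (∀ i, a i ≤ ε) →
      ∃ F ρ', 0 < F ∧ (∀ x, g x < 1 → ρ' x = F) ∧
        Transportable {x | g x < 1} ((1 + ε) ^ c)
          (fun x => 1 + ∑ j, a j * {y | gs j y < 1}.indicator (fun _ => 1) x) ρ' := by
  classical
  have hopen : IsOpen {x | g x < 1} := isOpen_lt hg.continuous continuous_const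
  -- By homogeneity of `g`, the segments from `p` to the centres lie in `{g < 1}`; compactness
  -- leaves a common margin around them.
  obtain ⟨η, hη, hηU⟩ : ∃ η : ℝ, 0 < η ∧
      ∀ i, Metric.cthickening (2 * η) (segment ℝ p (ps i)) ⊆ {x | g x < 1} := by
    have h1 : ∀ i, ∃ δ : ℝ, 0 < δ ∧
        Metric.cthickening δ (segment ℝ p (ps i)) ⊆ {x | g x < 1} := by
      intro i
      refine IsCompact.exists_cthickening_subset_open ?_ hopen ?_
      · rw [segment_eq_image']
        exact isCompact_Icc.image (by fun_prop)
      · rw [segment_eq_image']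
        rintro _ ⟨t, ht, rfl⟩
        change g _ < 1
        rw [hg.hom t ht.1, add_sub_cancel]
        have h2 : g (ps i) < 1 := hsub i _ (by rw [(hgs i).center]; exact one_pos)
        nlinarith [hg.nonneg (ps i), ht.1, ht.2]
    choose δ hδ hδU using h1
    obtain ⟨η, hη, hle⟩ : ∃ η : ℝ, 0 < η ∧ ∀ i, η ≤ δ i := by
      have : ∀ᶠ η in nhdsWithin (0 : ℝ) (Ioi 0), ∀ i, η ≤ δ i := by
        rw [Filter.eventually_all]
        exact fun i => nhdsWithin_le_nhds (ge_mem_nhds (hδ i))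
      obtain ⟨η, h1, h2⟩ := (this.and self_mem_nhdsWithin).exists
      exact ⟨η, h2, h1⟩
    refine ⟨η / 2, by positivity, fun i => (Metric.cthickening_mono ?_ _).trans (hδU i)⟩
    linarith [hle i]
  obtain ⟨l, hl, hl1, hb⟩ := hg.exists_isBump_gaugeBump hη
  choose ls hls hls1 hbs using fun i => (hgs i).exists_isBump_gaugeBump hη
  obtain ⟨M, hM, hlip⟩ := hb.lip
  choose Ms hMs hlips using fun i => (hbs i).lip
  choose κ hκ hmove using fun i => exists_transportable_move hη (hbs i) hb
    (gaugeBump_center_pos hg hl)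
  -- Each summand dominates the Lipschitz constant of the `j`-th bump both before and after its
  -- move, so one `A` serves every intermediate background.
  set A := ∑ j, (κ j * M + Ms j) with hA
  have hA0 : 0 ≤ A := Finset.sum_nonneg fun j _ => add_nonneg (mul_nonneg (hκ j) hM) (hMs j)
  choose k hk using fun i => hmove i A hA0
  choose Cs hCs hrads using fun i => exists_transportable_radial (hgs i) (hls i) (hls1 i)
  obtain ⟨C, hC, hrad⟩ := exists_transportable_radial hg hl hl1
  refine ⟨(∑ i, max (Cs i) 1) + (∑ i, k i) + max (C * ∑ i, κ i) 1, fun ε a hε ha haε => ?_⟩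
  have hε1 : 0 < 1 + ε := by positivity
  have hzero : ∀ i x, 1 ≤ gs i x → gaugeBump (gs i) (ls i) x = 0 := fun i x hx =>
    gaugeBump_eq_zero (hls i) ((hls1 i).le.trans hx)
  -- concentrate the excess mass of each piece near its centre
  have step₁ := Transportable.of_insert (U := {x | g x < 1}) hε1 (fun i => max (Cs i) 1)
    (fun S x => 1 + ∑ j, a j * if j ∈ S then gaugeBump (gs j) (ls j) x
      else {y | gs j y < 1}.indicator (fun _ => 1) x) (fun S i hi => by
    have hle : 1 + Cs i * a i ≤ 1 + Cs i * ε := by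
      linarith [mul_le_mul_of_nonneg_left (haε i) (hCs i)]
    refine (Transportable.symm ?_).mono (hle.trans (one_add_mul_le_rpow hε)) (hsub i)
    -- Disjointness removes all other terms on the `i`-th piece, where the density is therefore
    -- exactly what the radial move requires.
    have hother : ∀ (S : Finset (Fin n)) (x : Plane), gs i x < 1 → ∀ j ∈ Finset.univ, j ≠ i →
        (a j * if j ∈ S then gaugeBump (gs j) (ls j) x
          else {y | gs j y < 1}.indicator (fun _ => 1) x) = 0 := by
      intro S x hx j _ hji
      have h1 := hdisj i j hji.symm x hx
      rw [hzero j x h1, indicator_of_notMem (by simpa using h1)]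
      simp
    refine hrads i (a i) (ha i) _ _ (fun x hx => ?_) (fun x hx => ?_) (fun x hx => ?_)
    · rw [Finset.sum_eq_single i (hother _ x hx) (by simp), if_neg hi,
        indicator_of_mem (by simpa using hx), mul_one]
    · rw [Finset.sum_eq_single i (hother _ x hx) (by simp), if_pos (Finset.mem_insert_self _ _)]
      rfl
    · congr 1
      refine Finset.sum_congr rfl fun j _ => ?_
      by_cases hji : j = i
      · subst hji
        rw [if_neg hi, if_pos (Finset.mem_insert_self _ _), hzero j x hx.le,
          indicator_of_notMem (by simpa using hx.le)]
      · simp [Finset.mem_insert, hji]) Finset.univ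
  -- move all the bumps to the centre of `g`
  have step₂ := Transportable.of_insert (U := {x | g x < 1}) hε1 k
    (fun S x => 1 + ∑ j, a j * if j ∈ S then κ j * gaugeBump g l x
      else gaugeBump (gs j) (ls j) x) (fun S i hi => by
    have hterm_lip : ∀ j x y,
        |(a j * if j ∈ S then κ j * gaugeBump g l x else gaugeBump (gs j) (ls j) x)
          - (a j * if j ∈ S then κ j * gaugeBump g l y else gaugeBump (gs j) (ls j) y)|
        ≤ (κ j * M + Ms j) * (ε * dist x y) := by
      intro j x y
      rw [← mul_sub, abs_mul, abs_of_nonneg (ha j)]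
      have h1 : |(if j ∈ S then κ j * gaugeBump g l x else gaugeBump (gs j) (ls j) x)
          - (if j ∈ S then κ j * gaugeBump g l y else gaugeBump (gs j) (ls j) y)|
          ≤ (κ j * M + Ms j) * dist x y := by
        have h3 := hMs j
        have h4 := hκ j
        split_ifs
        · rw [← mul_sub, abs_mul, abs_of_nonneg (hκ j)]
          have := mul_le_mul_of_nonneg_left (hlip x y) h4
          have h5 : 0 ≤ Ms j * dist x y := by positivity
          linarith
        · have h5 : 0 ≤ κ j * M * dist x y := by positivity
          linarith [hlips j x y]
      calc _ ≤ ε * ((κ j * M + Ms j) * dist x y) :=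
            mul_le_mul (haε j) h1 (abs_nonneg _) hε
        _ = _ := by ring
    have h := hk i ε (a i) (ha i) (haε i)
      (fun x => ∑ j ∈ Finset.univ.erase i, a j * if j ∈ S then κ j * gaugeBump g l x
        else gaugeBump (gs j) (ls j) x)
      (fun x => Finset.sum_nonneg fun j _ => mul_nonneg (ha j) (by
        split_ifs
        · exact mul_nonneg (hκ j) (hb.nonneg x)
        · exact (hbs j).nonneg x))
      (fun x y => by
        rw [← Finset.sum_sub_distrib]
        refine (Finset.abs_sum_le_sum_abs _ _).trans ?_
        refine (Finset.sum_le_sum fun j _ => hterm_lip j x y).trans ?_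
        rw [hA, mul_assoc, Finset.sum_mul]
        refine Finset.sum_le_sum_of_subset_of_nonneg (Finset.erase_subset _ _) fun j _ _ => ?_
        have := hMs j
        have := hκ j
        positivity)
    convert h.mono le_rfl (hηU i) using 1
    · ext x
      rw [← Finset.add_sum_erase _ _ (Finset.mem_univ i), if_neg hi]
      ring
    · ext x
      rw [← Finset.add_sum_erase _ _ (Finset.mem_univ i), if_pos (Finset.mem_insert_self _ _),
        add_assoc, add_comm (a i * _)]
      congr 2
      refine Finset.sum_congr rfl fun j hj => ?_
      simp [Finset.mem_insert, Finset.ne_of_mem_erase hj]) Finset.univ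
  -- spread the central bump evenly
  set b := ∑ j, a j * κ j with hbdef
  have hb0 : 0 ≤ b := Finset.sum_nonneg fun j _ => mul_nonneg (ha j) (hκ j)
  have hbε : b ≤ (∑ j, κ j) * ε := by
    rw [hbdef, Finset.sum_mul]
    refine Finset.sum_le_sum fun j _ => ?_
    rw [mul_comm (κ j)]
    exact mul_le_mul_of_nonneg_right (haε j) (hκ j)
  have step₃ := hrad b hb0 (fun x => if g x < 1 then 1 + b else 1)
    (fun x => 1 + b * gaugeBump g l x) (fun x hx => if_pos hx) (fun x _ => rfl) (fun x hx => by
      rw [if_neg (not_lt.2 hx.le), gaugeBump_eq_zero hl (hl1.le.trans hx.le), mul_zero, add_zero])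
  have step₃' := step₃.mono (L₂ := (1 + ε) ^ max (C * ∑ i, κ i) 1)
    ((by nlinarith : 1 + C * b ≤ 1 + (C * ∑ i, κ i) * ε).trans (one_add_mul_le_rpow hε)) subset_rfl
  refine ⟨1 + b, fun x => if g x < 1 then 1 + b else 1, by positivity, fun x hx => if_pos hx, ?_⟩
  simp only [Finset.notMem_empty, if_false, Finset.mem_univ, if_true] at step₁ step₂
  refine (step₁.trans_rpow hε1 step₂).trans_rpow hε1 ?_
  convert step₃' using 1
  ext x
  rw [hbdef, Finset.sum_mul]
  simp only [mul_assoc]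

theorem proposition3p2 (T : Set Plane) (p : Plane) (hT : IsStarDomain T p)
    (n : ℕ) (Ti : Fin n → Set Plane) (pt : Fin n → Plane)
    (hTi : ∀ i, IsStarDomain (Ti i) (pt i)) (hpart : IsTilingOf T Ti) :
    ∃ C₁ : ℝ, ∀ f : Plane → ℝ, (∀ x ∈ T, 0 < f x) →
      (∀ i, ∃ c : ℝ, ∀ x ∈ interior (Ti i), f x = c) →
      ∃ φ : Plane → Plane,
        IsBiLipSelfMap
          ((sSup (f '' ⋃ i, interior (Ti i)) / sInf (f '' ⋃ i, interior (Ti i))) ^ C₁) φ T ∧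
        (∀ x ∈ frontier T, φ x = x) ∧
        ∀ᵐ x ∂(volume.restrict T), DifferentiableAt ℝ φ x ∧
          (fderiv ℝ φ x).det = volume.real T / (∫ y in T, f y) * f x := by
  have hTiT : ∀ i, Ti i ⊆ T := fun i => hpart.iUnion_eq ▸ subset_iUnion Ti i
  obtain ⟨K, R, hg⟩ := hT.isRadialGauge
  choose Ks Rs hgs using fun i => (hTi i).isRadialGauge
  have hint : {x | starGauge T p x < 1} = interior T :=
    Set.ext fun x => (hT.mem_interior_iff_starGauge_lt x).symm
  have hints : ∀ i, {x | starGauge (Ti i) (pt i) x < 1} = interior (Ti i) := fun i =>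
    Set.ext fun x => ((hTi i).mem_interior_iff_starGauge_lt x).symm
  obtain ⟨c, hc⟩ := exists_transportable_const hg hgs
    (fun i x hx => (hT.mem_interior_iff_starGauge_lt x).1
      (interior_mono (hTiT i) (((hTi i).mem_interior_iff_starGauge_lt x).2 hx)))
    (fun i j hij x hx => not_lt.1 fun hx' => (hpart.disjoint_interior i j hij).le_bot
      ⟨((hTi i).mem_interior_iff_starGauge_lt x).2 hx,
        ((hTi j).mem_interior_iff_starGauge_lt x).2 hx'⟩)
  simp only [hint, hints] at hc
  refine ⟨c, fun f hf hfc => ?_⟩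
  choose v hv using hfc
  have hvpt : ∀ i, f (pt i) = v i := fun i => hv i _ (hTi i).mem_interior
  have himg : f '' ⋃ i, interior (Ti i) = range v := by
    ext y
    constructor
    · rintro ⟨x, hx, rfl⟩
      obtain ⟨i, hi⟩ := mem_iUnion.1 hx
      exact ⟨i, (hv i x hi).symm⟩
    · rintro ⟨i, rfl⟩
      exact ⟨pt i, mem_iUnion.2 ⟨i, (hTi i).mem_interior⟩, hvpt i⟩
  rw [himg]
  have hpT : p ∈ T := interior_subset hT.mem_interior
  -- There is at least one piece, so the supremum and infimum of the values are attained.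
  obtain ⟨i₀, -⟩ := mem_iUnion.1 (hpart.iUnion_eq.symm ▸ hpT : p ∈ ⋃ i, Ti i)
  have hne : (range v).Nonempty := ⟨v i₀, i₀, rfl⟩
  have hfin : (range v).Finite := finite_range v
  set m := sInf (range v) with hm
  set M := sSup (range v)
  have hm0 : 0 < m := by
    obtain ⟨i, hi⟩ := hne.csInf_mem hfin
    rw [hm, ← hi, ← hvpt i]
    exact hf _ (hTiT i (interior_subset (hTi i).mem_interior))
  have hmv : ∀ i, m ≤ v i := fun i => csInf_le hfin.bddBelow ⟨i, rfl⟩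
  have hvM : ∀ i, v i ≤ M := fun i => le_csSup hfin.bddAbove ⟨i, rfl⟩
  -- Dividing by the minimum makes the density at least `1`, and `1 + ε` becomes the ratio `M / m`.
  obtain ⟨F, ρ', hF, hρ', φ, hφ⟩ := hc (M / m - 1) (fun i => v i / m - 1)
    (sub_nonneg.2 ((one_le_div hm0).2 ((hmv i₀).trans (hvM i₀))))
    (fun i => sub_nonneg.2 ((one_le_div hm0).2 (hmv i)))
    (fun i => by have := hvM i; gcongr)
  rw [add_sub_cancel] at hφ
  refine ⟨φ, hφ.isBiLipSelfMap, fun x hx => hφ.eq_off x hx.2, ?_⟩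
  have hvol : volume.real T ≠ 0 := by
    refine (ENNReal.toReal_pos (ne_of_gt ?_) hT.isCompact.measure_lt_top.ne).ne'
    exact (isOpen_interior.measure_pos volume ⟨p, hT.mem_interior⟩).trans_le
      (measure_mono interior_subset)
  refine hφ.ae_det_eq hT.isCompact.measurableSet hvol hT.volume_frontier hF
    (fun x hx => hρ' x ((hT.mem_interior_iff_starGauge_lt x).1 hx)) hm0 hf ?_
  -- The values of `f` on the boundaries of the pieces do not matter, since these are null.
  have hfr : ∀ᵐ x, ∀ i, x ∉ frontier (Ti i) := by
    rw [ae_all_iff]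
    intro i
    rw [ae_iff]
    simpa using (hTi i).volume_frontier
  filter_upwards [hfr] with x hx hxT
  obtain ⟨i, hi⟩ := mem_iUnion.1 (hpart.iUnion_eq.symm ▸ hxT : x ∈ ⋃ i, Ti i)
  have hxi : x ∈ interior (Ti i) := by
    by_contra hn
    exact hx i ⟨subset_closure hi, hn⟩
  rw [Finset.sum_eq_single i, indicator_of_mem hxi, hv i x hxi]
  · field_simp
    ring
  · intro j _ hji
    rw [indicator_of_notMem, mul_zero]
    exact fun hxj => (hpart.disjoint_interior i j hji.symm).le_bot ⟨hxi, hxj⟩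
  · simp
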